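/- **Programs.** Consider the untyped programs, taken modulo renaming of bound variables, $$M,N ::= a \mid \lambda a.M \mid M\,N \mid M{\downarrow}N \mid \mathbf{rec}\,M \mid \bot \mid \mathbf{Nil} \mid \mathbf{Left}(M) \mid \mathbf{Right}(M) \mid \mathbf{Pair}(M,N) \mid \mathbf{Amb}(M,N) \mid$$ $$\mathbf{case}\,M\,\{\mathbf{Left}(a)\to L;\mathbf{Right}(b)\to R\} \mid \mathbf{case}\,M\,\{\mathbf{Pair}(a,b)\to N\} \mid \mathbf{case}\,M\,\{\mathbf{Amb}(a,b)\to N\}.$$ The constructors other than $\mathbf{Amb}$ are called data constructors; $M{\downarrow}N$ is strict application. **Denotations.** Let $D$ be the Scott domain that is the initial solution of $D=(\mathbf{Nil}+\mathbf{Left}(D)+\mathbf{Right}(D)+\mathbf{Pair}(D\times D)+\mathbf{Amb}(D\times D)+\mathbf{Fun}(D\to D))_\bot$ (separated sums, Scott continuous functions). For an environment $\eta$ the denotation $[\![M]\!]\eta\in D$ is: $[\![a]\!]\eta=\eta(a)$; $[\![\lambda a.M]\!]\eta=\mathbf{Fun}(f)$ with $f(d)=[\![M]\!]\eta[a\mapsto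 d]$; if $[\![M]\!]\eta=\mathbf{Fun}(f)$ then $[\![M\,N]\!]\eta=f([\![N]\!]\eta)$, $[\![M{\downarrow}N]\!]\eta=f([\![N]\!]\eta)$ provided $[\![N]\!]\eta\neq\bot$, and $[\![\mathbf{rec}\,M]\!]\eta$ is the least fixed point of $f$; constructors are interpreted by the constructors of $D$; $[\![\mathbf{case}\,M\{\ldots\}]\!]\eta=[\![K]\!]\eta[\vec a\mapsto\vec d]$ if $[\![M]\!]\eta=C(\vec d)$ and $C(\vec a)\to K$ is a clause; in all other cases the value is $\bot$. For closed $M$ write $[\![M]\!]$. **Data.** The relation $d\in\mathrm{data}(a)$ on $D$ is the largest relation such that $d\in\mathrm{data}(a)$ iff one of the following holds: $a=\mathbf{Amb}(a',b')$, $a'\ne\bot$ and $d\in\mathrm{data}(a')$; $a=\mathbf{Amb}(a',b')$, $b'\neq\bot$ and $d\in\mathrm{data}(b')$; $a=\mathbf{Amb}(\bot,\bot)$ and $d=\bot$; $a=C(\vec{a'})$ and $d=C(\vec{d'})$ for a data constructor $C$ with $d'_i\in\mathrm{data}(a'_i)$ for all $i$; $a=\mathbf{Fun}(f)$ and $d=a$;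 $a=d=\bot$. **Types.** Types are $\rho,\sigma::=\alpha\mid\mathbf 1\mid\rho\times\sigma\mid\rho+\sigma\mid\rho\Rightarrow\sigma\mid\mathbf{fix}\,\alpha.\rho\mid\mathbf A(\rho)$. A type is *determined* if it has the form $\mathbf{fix}\,\alpha_1\ldots\mathbf{fix}\,\alpha_n.\rho$ ($n\ge0$) with $\rho$ of the form $\mathbf1$, $\rho_1\times\rho_2$, $\rho_1+\rho_2$ or $\rho_1\Rightarrow\rho_2$. It is *properly strictly positive in $\alpha$* if it contains $\alpha$ free, is different from $\alpha$, and has no free occurrence of $\alpha$ in the left side of a function type. It is *regular* if for every subtype $\mathbf A(\rho)$, $\rho$ is determined, and for every subtype $\mathbf{fix}\,\alpha.\rho$, $\rho$ is properly strictly positive in $\alpha$. A *subdomain* of $D$ is a downward closed subset closed under suprema of bounded subsets. For $\zeta$ assigning subdomains to type variables, $[\![\alpha]\!]\zeta=\zeta(\alpha)$; $[\![\mathbf1]\!]\zeta=\{\mathbf{Nil},\bot\}$; $[\![\rho\times\sigma]\!]\zeta=\{\mathbf{Pair}(a,b)\mid a\in[\![\rho]\!]\zeta,b\in[\![\sigma]\!]\zeta\}\cup\{\bot\}$;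 $[\![\rho+\sigma]\!]\zeta=\{\mathbf{Left}(a)\mid a\in[\![\rho]\!]\zeta\}\cup\{\mathbf{Right}(b)\mid b\in[\![\sigma]\!]\zeta\}\cup\{\bot\}$; $[\![\rho\Rightarrow\sigma]\!]\zeta=\{\mathbf{Fun}(f)\mid f:D\to D\text{ continuous},\ f([\![\rho]\!]\zeta)\subseteq[\![\sigma]\!]\zeta\}\cup\{\bot\}$; $[\![\mathbf A(\rho)]\!]\zeta=\{\mathbf{Amb}(a,b)\mid a,b\in[\![\rho]\!]\zeta\}\cup\{\bot\}$; and $[\![\mathbf{fix}\,\alpha.\rho]\!]\zeta$ is the intersection of all subdomains $X$ with $[\![\rho]\!]\zeta[\alpha\mapsto X]\subseteq X$. For closed $\rho$ write $[\![\rho]\!]$. **Reduction.** A *w.h.n.f.* is a program that begins with a constructor (including $\mathbf{Amb}$) or is a $\lambda$-abstraction. *$\bot$-like* programs are $\bot$, $C(\vec M)\,N$, $C(\vec M){\downarrow}N$, and $\mathbf{case}\,M\{\ldots\}$ with $M$ a w.h.n.f. that matches no clause. The relation $\rightsquigarrow$ is generated by: $(\lambda a.M)\,N\rightsquigarrow M[N/a]$;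 $M\,N\rightsquigarrow M'\,N$ if $M\rightsquigarrow M'$; $(\lambda a.M){\downarrow}N\rightsquigarrow M[N/a]$ if $N$ is a w.h.n.f.; $M{\downarrow}N\rightsquigarrow M'{\downarrow}N$ if $M\rightsquigarrow M'$ and $N$ is a w.h.n.f.; $M{\downarrow}N\rightsquigarrow M{\downarrow}N'$ if $N\rightsquigarrow N'$; $\mathbf{rec}\,M\rightsquigarrow M\,(\mathbf{rec}\,M)$; $\mathbf{case}\,C(\vec M)\{\ldots;C(\vec b)\to N;\ldots\}\rightsquigarrow N[\vec M/\vec b]$; $\mathbf{case}\,M\{\ldots\}\rightsquigarrow\mathbf{case}\,M'\{\ldots\}$ if $M\rightsquigarrow M'$; $M\rightsquigarrow\bot$ if $M$ is $\bot$-like. The relation $\rightsquigarrow_c$ is generated by: $M\rightsquigarrow_c M'$ if $M\rightsquigarrow M'$; $\mathbf{Amb}(M_1,M_2)\rightsquigarrow_c\mathbf{Amb}(M_1',M_2)$ if $M_1\rightsquigarrow M_1'$ (a left step); $\mathbf{Amb}(M_1,M_2)\rightsquigarrow_c\mathbf{Amb}(M_1,M_2')$ if $M_2\rightsquigarrow M_2'$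 (a right step); $\mathbf{Amb}(M_1,M_2)\rightsquigarrow_c M_i$ if $M_i$ is a w.h.n.f. The relation $\rightsquigarrow_p$ is generated by: $M\rightsquigarrow_p M'$ if $M\rightsquigarrow_c M'$; $C(\vec M)\rightsquigarrow_p C(\vec{M'})$ if $C$ is a data constructor and $M_i\rightsquigarrow_p M_i'$ for all $i$; $\lambda a.M\rightsquigarrow_p\lambda a.M$. **Computations.** In an infinite reduction sequence $M_0\rightsquigarrow_p M_1\rightsquigarrow_p\cdots$ each step comes with the shape of its derivation (the rules that are used in it), so that a left step and a right step of $\mathbf{Amb}$ are distinguished even if they lead to the same program. Unfair sequences are defined inductively: the sequence is unfair if $M_i=\mathbf{Amb}(L_i,R)$ with fixed $R$ and $L_i\rightsquigarrow L_{i+1}$ for all $i$ and all steps are left steps; or, symmetrically, $M_i=\mathbf{Amb}(L,R_i)$ with fixed $L$ and $R_i\rightsquigarrow R_{i+1}$ for all $i$ and all steps are right steps; or $M_i=C(N_{i,1},\ldots,N_{i,n})$ with a fixed data constructor $C$, all steps reduce the arguments in parallel, and for some $k$ the sequence $N_{0,k}\rightsquigarrow_p N_{1,k}\rightsquigarrow_p\cdots$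 is unfair; or the tail $M_1\rightsquigarrow_p M_2\rightsquigarrow_p\cdots$ is unfair. A *computation* of a closed program $M$ is an infinite sequence $M=M_0\rightsquigarrow_p M_1\rightsquigarrow_p\cdots$ of closed programs that is fair, i.e. not unfair. For a closed program $M$ define $M_D\in D$ by $C(M_1,\ldots,M_k)_D=C((M_1)_D,\ldots,(M_k)_D)$ for data constructors $C$, $(\lambda a.M)_D=[\![\lambda a.M]\!]$, and $M_D=\bot$ otherwise. **Theorem (Computational Adequacy: Completeness).** Let $M$ be a closed program that is a member of a closed regular type $\rho$, that is, $[\![M]\!]\in[\![\rho]\!]$. Then for every $d\in\mathrm{data}([\![M]\!])$ there is a computation $M=M_0\rightsquigarrow_p M_1\rightsquigarrow_p\cdots$ such that $d=\bigsqcup_{i\in\mathbb N}(M_i)_D$. -/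

import Mathlib

namespace AmbLang

/-! ## The Scott domain `D` -/

/-- The separated sum `(Nil + Left(X) + Right(X) + Pair(X × X) + Amb(X × X) + Fun(G))_⊥`. -/
inductive Shape (X G : Type) : Type
  | bot : Shape X G
  | nil : Shape X G
  | left (x : X) : Shape X G
  | right (x : X) : Shape X G
  | pair (x y : X) : Shape X G
  | amb (x y : X) : Shape X G
  | fn (g : G) : Shape X G

namespace Shape

variable {X Y Z G H K : Type}

/-- The order of the lifted separated sum: `bot` is least, elements with the same constructor are
compared componentwise, elements with different constructors are incomparable. -/
inductive Le [LE X] [LE G] : Shape X G → Shape X G → Prop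
  | bot (s : Shape X G) : Le .bot s
  | nil : Le .nil .nil
  | left {x x' : X} (h : x ≤ x') : Le (.left x) (.left x')
  | right {x x' : X} (h : x ≤ x') : Le (.right x) (.right x')
  | pair {x x' y y' : X} (h : x ≤ x') (k : y ≤ y') : Le (.pair x y) (.pair x' y')
  | amb {x x' y y' : X} (h : x ≤ x') (k : y ≤ y') : Le (.amb x y) (.amb x' y')
  | fn {g g' : G} (h : g ≤ g') : Le (.fn g) (.fn g')

instance [LE X] [LE G] : LE (Shape X G) := ⟨Le⟩

instance [PartialOrder X] [PartialOrder G] : PartialOrder (Shape X G) where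
  le := Le
  le_refl s := by cases s <;> constructor <;> exact le_rfl
  le_trans a b c hab hbc := by
    cases hab <;> cases hbc <;> constructor <;> exact le_trans (by assumption) (by assumption)
  le_antisymm a b hab hba := by
    cases hab <;> cases hba <;> congr <;> exact le_antisymm (by assumption) (by assumption)

instance [PartialOrder X] [PartialOrder G] : OrderBot (Shape X G) where
  bot := .bot
  bot_le s := Le.bot s

instance [Finite X] [Finite G] : Finite (Shape X G) := by
  let f : Shape X G → Bool ⊕ (X ⊕ X) ⊕ ((X × X) ⊕ (X × X)) ⊕ G := fun s => match s with
    | .bot => .inl true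
    | .nil => .inl false
    | .left x => .inr (.inl (.inl x))
    | .right x => .inr (.inl (.inr x))
    | .pair x y => .inr (.inr (.inl (.inl (x, y))))
    | .amb x y => .inr (.inr (.inl (.inr (x, y))))
    | .fn g => .inr (.inr (.inr g))
  refine Finite.of_injective f ?_
  intro s t h
  cases s <;> cases t <;> simp_all [f]

/-- Functoriality of `Shape` for monotone maps. -/
def map [PartialOrder X] [PartialOrder Y] [PartialOrder G] [PartialOrder H]
    (f : X →o Y) (g : G →o H) : Shape X G →o Shape Y H where
  toFun s := match s with
    | .bot => .bot
    | .nil => .nil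
    | .left x => .left (f x)
    | .right x => .right (f x)
    | .pair x y => .pair (f x) (f y)
    | .amb x y => .amb (f x) (f y)
    | .fn k => .fn (g k)
  monotone' s t h := by
    cases h <;> constructor <;> first | exact f.monotone (by assumption) | exact g.monotone (by assumption)

end Shape

/-- `h ↦ f ∘ h ∘ g` on spaces of monotone functions. -/
def conj {X Y : Type} [PartialOrder X] [PartialOrder Y] (f : X →o Y) (g : Y →o X) :
    (X →o X) →o (Y →o Y) where
  toFun h := (f.comp h).comp g
  monotone' _ _ h y := f.monotone (h (g y))

/-- A finite partial order with a least element. -/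
structure FinPos where
  /-- the underlying type -/
  carrier : Type
  [ord : PartialOrder carrier]
  [bot : OrderBot carrier]
  [fin : Finite carrier]

attribute [instance] FinPos.ord FinPos.bot FinPos.fin

instance {X : Type} [PartialOrder X] [Finite X] : Finite (X →o X) :=
  Finite.of_injective (fun f : X →o X => (f : X → X)) DFunLike.coe_injective

/-- The finite approximations of `D`: `D₀` is the one-point order and
`Dₙ₊₁ = (Nil + Left(Dₙ) + Right(Dₙ) + Pair(Dₙ × Dₙ) + Amb(Dₙ × Dₙ) + Fun(Dₙ → Dₙ))_⊥`.
Between finite orders the continuous functions are the monotone ones. -/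
def lvl : ℕ → FinPos
  | 0 => ⟨Unit⟩
  | n + 1 => ⟨Shape (lvl n).carrier ((lvl n).carrier →o (lvl n).carrier)⟩

/-- The carrier of the `n`-th approximation. -/
abbrev Lv (n : ℕ) : Type := (lvl n).carrier

/-- The carrier of the `n+1`-st approximation, unfolded. -/
abbrev LvS (n : ℕ) : Type := Shape (Lv n) (Lv n →o Lv n)

/-- The canonical maps between approximations, in both directions: the embedding-projection pair
obtained by functoriality from the unique maps at level `0`. -/
def trPair : (n m : ℕ) → (Lv n →o Lv m) × (Lv m →o Lv n)
  | 0, _ => (⊥, ⊥)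
  | _ + 1, 0 => (⊥, ⊥)
  | n + 1, m + 1 =>
    let p := trPair n m
    ((Shape.map p.1 (conj p.1 p.2) : LvS n →o LvS m), (Shape.map p.2 (conj p.2 p.1) : LvS m →o LvS n))

/-- The canonical map `Dₙ → Dₘ`: an embedding for `n ≤ m`, a projection for `m ≤ n`. -/
def tr (n m : ℕ) : Lv n →o Lv m := (trPair n m).1

theorem trPair_swap (n m : ℕ) :
    (trPair n m).2 = (trPair m n).1 ∧ (trPair n m).1 = (trPair m n).2 := by
  induction n generalizing m with
  | zero => cases m <;> exact ⟨rfl, rfl⟩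
  | succ n ih =>
    cases m with
    | zero => exact ⟨rfl, rfl⟩
    | succ m =>
      simp only [trPair, (ih m).1, (ih m).2]
      exact ⟨rfl, rfl⟩

theorem tr_succ (n m : ℕ) :
    tr (n + 1) (m + 1) = (Shape.map (tr n m) (conj (tr n m) (tr m n)) : LvS n →o LvS m) := by
  have h := (trPair_swap n m).1
  simp only [tr, trPair, h]
  rfl

theorem tr_bot (n m : ℕ) : tr n m ⊥ = ⊥ := by
  cases n with
  | zero => cases m <;> rfl
  | succ n =>
    cases m with
    | zero => rfl
    | succ m => rw [tr_succ]; rfl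

theorem tr_zero_left (m : ℕ) (x : Lv 0) : tr 0 m x = ⊥ := tr_bot 0 m

theorem tr_zero_right (n : ℕ) (x : Lv n) : tr n 0 x = ⊥ := rfl

theorem tr_comp (n m k : ℕ) (h : n ≤ m ∨ k ≤ m) (x : Lv n) :
    tr m k (tr n m x) = tr n k x := by
  induction m generalizing n k with
  | zero =>
    rcases h with h | h
    · obtain rfl : n = 0 := by omega
      rw [tr_zero_left, tr_zero_left]
    · obtain rfl : k = 0 := by omega
      rfl
  | succ m ih =>
    cases n with
    | zero => rw [tr_zero_left, tr_zero_left, tr_bot]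
    | succ n =>
      cases k with
      | zero => rfl
      | succ k =>
        have h1 : n ≤ m ∨ k ≤ m := by omega
        have h2 : k ≤ m ∨ n ≤ m := by omega
        rw [tr_succ, tr_succ, tr_succ]
        have e1 := ih n k h1
        have e2 := ih k n h2
        change LvS n at x
        cases x with
        | bot => rfl
        | nil => rfl
        | left x => exact congrArg Shape.left (e1 x)
        | right x => exact congrArg Shape.right (e1 x)
        | pair x y => exact congrArg₂ Shape.pair (e1 x) (e1 y)
        | amb x y => exact congrArg₂ Shape.amb (e1 x) (e1 y)
        | fn g =>
          refine congrArg Shape.fn (OrderHom.ext _ _ (funext fun u => ?_))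
          change tr m k (tr n m (g (tr m n (tr k m u)))) = tr n k (g (tr k n u))
          rw [e1, e2]

theorem tr_le (n m : ℕ) (x : Lv n) : tr m n (tr n m x) ≤ x := by
  induction n generalizing m with
  | zero => exact le_rfl
  | succ n ih =>
    cases m with
    | zero => rw [tr_zero_left]; exact bot_le
    | succ m =>
      rw [tr_succ, tr_succ]
      change LvS n at x
      cases x with
      | bot => exact Shape.Le.bot _
      | nil => exact Shape.Le.nil
      | left x => exact Shape.Le.left (ih m x)
      | right x => exact Shape.Le.right (ih m x)
      | pair x y => exact Shape.Le.pair (ih m x) (ih m y)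
      | amb x y => exact Shape.Le.amb (ih m x) (ih m y)
      | fn g =>
        refine Shape.Le.fn fun u => ?_
        change tr m n (tr n m (g (tr m n (tr n m u)))) ≤ g u
        exact (ih m _).trans (g.monotone (ih m u))

theorem tr_self (n : ℕ) (x : Lv n) : tr n n x = x := by
  induction n with
  | zero => rfl
  | succ n ih =>
    rw [tr_succ]
    change LvS n at x
    cases x with
    | bot => rfl
    | nil => rfl
    | left x => exact congrArg Shape.left (ih x)
    | right x => exact congrArg Shape.right (ih x)
    | pair x y => exact congrArg₂ Shape.pair (ih x) (ih y)
    | amb x y => exact congrArg₂ Shape.amb (ih x) (ih y)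
    | fn g =>
      refine congrArg Shape.fn (OrderHom.ext _ _ (funext fun u => ?_))
      change tr n n (g (tr n n u)) = g u
      rw [ih, ih]

/-- The domain `D`: the inverse limit of the finite approximations `Dₙ` along the projections,
ordered componentwise. It is the initial solution of the domain equation
`D = (Nil + Left(D) + Right(D) + Pair(D × D) + Amb(D × D) + Fun(D → D))_⊥`. -/
@[ext]
structure D : Type where
  /-- the `n`-th approximation -/
  cut : ∀ n, Lv n
  coh : ∀ n m, n ≤ m → tr m n (cut m) = cut n

namespace D

instance : PartialOrder D where
  le a b := ∀ n, a.cut n ≤ b.cut n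
  le_refl _ _ := le_rfl
  le_trans _ _ _ h k n := (h n).trans (k n)
  le_antisymm _ _ h k := D.ext (funext fun n => le_antisymm (h n) (k n))

theorem le_iff {a b : D} : a ≤ b ↔ ∀ n, a.cut n ≤ b.cut n := Iff.rfl

instance : OrderBot D where
  bot := ⟨fun _ => ⊥, fun n m _ => tr_bot m n⟩
  bot_le _ _ := bot_le

theorem bot_cut (n : ℕ) : (⊥ : D).cut n = ⊥ := rfl

/-- The embedding of the `n`-th approximation into `D`. -/
def emb (n : ℕ) : Lv n →o D where
  toFun x := ⟨fun m => tr n m x, fun a b h => tr_comp n b a (Or.inr h) x⟩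
  monotone' _ _ h m := (tr n m).monotone h

theorem emb_cut (n m : ℕ) (x : Lv n) : (emb n x).cut m = tr n m x := rfl

theorem emb_tr (n m : ℕ) (h : n ≤ m) (x : Lv n) : emb m (tr n m x) = emb n x :=
  D.ext (funext fun k => tr_comp n m k (Or.inl h) x)

theorem emb_cut_le (n : ℕ) (d : D) : emb n (d.cut n) ≤ d := by
  intro m
  rw [emb_cut]
  rcases le_total n m with h | h
  · rw [← d.coh n m h]; exact tr_le m n _
  · rw [d.coh m n h]

theorem emb_cut_mono (d : D) {n m : ℕ} (h : n ≤ m) : emb n (d.cut n) ≤ emb m (d.cut m) := by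
  rw [← emb_tr n m h, ← d.coh n m h]
  exact (emb m).monotone (tr_le m n _)

theorem cut_mono {a b : D} (h : a ≤ b) (n : ℕ) : a.cut n ≤ b.cut n := h n

/-- Least upper bounds of directed sets exist and are attained at every finite level. -/
theorem exists_isLUB {S : Set D} (hne : S.Nonempty) (hd : DirectedOn (· ≤ ·) S) :
    ∃ a, IsLUB S a ∧ ∀ n, ∃ s ∈ S, s.cut n = a.cut n := by
  have hmax : ∀ n, ∃ s ∈ S, ∀ t ∈ S, t.cut n ≤ s.cut n := by
    intro n
    obtain ⟨m, hm⟩ := ((Set.toFinite ((fun s : D => s.cut n) '' S))).exists_maximal (hne.image _)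
    obtain ⟨⟨s, hs, rfl⟩, hm⟩ := hm
    refine ⟨s, hs, fun t ht => ?_⟩
    obtain ⟨u, hu, hsu, htu⟩ := hd s hs t ht
    exact (htu n).trans (hm ⟨u, hu, rfl⟩ (hsu n))
  choose s hs hmax using hmax
  refine ⟨⟨fun n => (s n).cut n, fun n m h => ?_⟩, ⟨fun t ht n => hmax n t ht, fun b hb n => hb (hs n) n⟩,
    fun n => ⟨s n, hs n, rfl⟩⟩
  rw [(s m).coh n m h]
  refine le_antisymm (hmax n _ (hs m)) ?_
  rw [← (s n).coh n m h, ← (s m).coh n m h]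
  exact (tr m n).monotone (hmax m _ (hs n))

theorem attain {S : Set D} (hne : S.Nonempty) (hd : DirectedOn (· ≤ ·) S) {a : D}
    (ha : IsLUB S a) (n : ℕ) : ∃ s ∈ S, s.cut n = a.cut n := by
  obtain ⟨b, hb, h⟩ := exists_isLUB hne hd
  rw [ha.unique hb]
  exact h n

end D

section Scott

variable {α : Type} [Preorder α]

/-- A map into `D` is Scott continuous iff it is monotone and every finite level of its value at a
directed least upper bound is attained. -/
theorem scott_iff {f : α → D} : ScottContinuous f ↔ Monotone f ∧
    ∀ S : Set α, S.Nonempty → DirectedOn (· ≤ ·) S → ∀ a, IsLUB S a → ∀ n, ∃ s ∈ S,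
      (f s).cut n = (f a).cut n := by
  constructor
  · intro h
    refine ⟨h.monotone, fun S hne hd a ha n => ?_⟩
    obtain ⟨_, ⟨s, hs, rfl⟩, h⟩ := D.attain (hne.image f) (hd.mono_comp fun _ _ h' => h.monotone h') (h hne hd ha) n
    exact ⟨s, hs, h⟩
  · rintro ⟨hm, h⟩ S hne hd a ha
    refine ⟨?_, fun b hb n => ?_⟩
    · rintro _ ⟨s, hs, rfl⟩
      exact hm (ha.1 hs)
    · obtain ⟨s, hs, e⟩ := h S hne hd a ha n
      rw [← e]
      exact hb ⟨s, hs, rfl⟩ n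

/-- The chain of finite approximations. -/
theorem D.isLUB_emb (d : D) : IsLUB (Set.range fun n => D.emb n (d.cut n)) d := by
  refine ⟨?_, fun b hb n => ?_⟩
  · rintro _ ⟨n, rfl⟩
    exact D.emb_cut_le n d
  · have := hb ⟨n, rfl⟩ n
    simpa [D.emb_cut, tr_self] using this

/-- The Scott continuous maps between two preorders, ordered pointwise. -/
abbrev SMap (α β : Type) [Preorder α] [Preorder β] : Type := {f : α → β // ScottContinuous f}

end Scott

namespace D

/-- The domain equation, from right to left: the constructors of `D`. -/
def roll (s : Shape D (SMap D D)) : D where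
  cut n := match n with
    | 0 => ⊥
    | n + 1 => (match s with
      | .bot => .bot
      | .nil => .nil
      | .left a => .left (a.cut n)
      | .right a => .right (a.cut n)
      | .pair a b => .pair (a.cut n) (b.cut n)
      | .amb a b => .amb (a.cut n) (b.cut n)
      | .fn f => .fn ⟨fun x => (f.1 (emb n x)).cut n,
          fun _ _ h => f.2.monotone ((emb n).monotone h) n⟩ : LvS n)
  coh n m h := by
    cases n with
    | zero => rfl
    | succ n =>
      obtain ⟨m, rfl⟩ : ∃ k, m = k + 1 := ⟨m - 1, by omega⟩
      have h' : n ≤ m := by omega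
      rw [tr_succ]
      cases s with
      | bot => rfl
      | nil => rfl
      | left a => exact congrArg Shape.left (a.coh n m h')
      | right a => exact congrArg Shape.right (a.coh n m h')
      | pair a b => exact congrArg₂ Shape.pair (a.coh n m h') (b.coh n m h')
      | amb a b => exact congrArg₂ Shape.amb (a.coh n m h') (b.coh n m h')
      | fn f =>
        refine congrArg Shape.fn (OrderHom.ext _ _ (funext fun x => ?_))
        change tr m n ((f.1 (emb m (tr n m x))).cut m) = (f.1 (emb n x)).cut n
        rw [emb_tr n m h', (f.1 (emb n x)).coh n m h']

theorem roll_mono : Monotone roll := by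
  intro s t h n
  cases n with
  | zero => exact le_rfl
  | succ n =>
    cases h with
    | bot => exact Shape.Le.bot _
    | nil => exact Shape.Le.nil
    | left h => exact Shape.Le.left (h n)
    | right h => exact Shape.Le.right (h n)
    | pair h k => exact Shape.Le.pair (h n) (k n)
    | amb h k => exact Shape.Le.amb (h n) (k n)
    | fn h => exact Shape.Le.fn fun x => h _ n

theorem le_of_roll_le {s t : Shape D (SMap D D)} (h : roll s ≤ roll t) : s ≤ t := by
  have h1 : ∀ n, Shape.Le ((roll s).cut (n + 1) : LvS n) ((roll t).cut (n + 1) : LvS n) :=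
    fun n => h (n + 1)
  cases s <;> cases t <;> first
    | exact Shape.Le.bot _
    | exact Shape.Le.nil
    | (exfalso; have := h1 0; simp only [roll] at this; cases this; done)
    | skip
  · exact Shape.Le.left fun n => by have := h1 n; simp only [roll] at this; cases this; assumption
  · exact Shape.Le.right fun n => by have := h1 n; simp only [roll] at this; cases this; assumption
  · exact Shape.Le.pair (fun n => by have := h1 n; simp only [roll] at this; cases this; assumption)
      (fun n => by have := h1 n; simp only [roll] at this; cases this; assumption)
  · exact Shape.Le.amb (fun n => by have := h1 n; simp only [roll] at this; cases this; assumption)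
      (fun n => by have := h1 n; simp only [roll] at this; cases this; assumption)
  · rename_i f g
    refine Shape.Le.fn fun y => ?_
    refine (f.2 (Set.range_nonempty _) ?_ (D.isLUB_emb y)).2 ?_
    · exact directedOn_range.2 (Monotone.directed_le fun _ _ h => emb_cut_mono y h)
    · rintro _ ⟨_, ⟨n, rfl⟩, rfl⟩ k
      refine le_trans ?_ (g.2.monotone (emb_cut_le n y) k)
      rcases le_total k n with hk | hk
      · have := h1 n
        simp only [roll] at this
        cases this with
        | fn this =>
          have h2 : tr n k ((f.1 (emb n (y.cut n))).cut n) ≤ tr n k ((g.1 (emb n (y.cut n))).cut n) :=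
            (tr n k).monotone (this (y.cut n))
          rwa [coh _ k n hk, coh _ k n hk] at h2
      · have := h1 k
        simp only [roll] at this
        cases this with
        | fn this =>
          have h2 : (f.1 (emb k (tr n k (y.cut n)))).cut k ≤ (g.1 (emb k (tr n k (y.cut n)))).cut k :=
            this (tr n k (y.cut n))
          rwa [emb_tr n k hk] at h2

end D

namespace Shape

variable {X Y G H : Type} [PartialOrder X] [OrderBot X] [PartialOrder Y] [OrderBot Y]

/-- First component, `⊥` if there is none. -/
def fst : Shape X G → X
  | .left x => x
  | .right x => x
  | .pair x _ => x
  | .amb x _ => x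
  | _ => ⊥

/-- Second component, `⊥` if there is none. -/
def snd : Shape X G → X
  | .pair _ y => y
  | .amb _ y => y
  | _ => ⊥

/-- The function component, constantly `⊥` if there is none. -/
def fnOf : Shape X (X →o X) → (X →o X)
  | .fn g => g
  | _ => ⊥

theorem fst_mono [PartialOrder G] {s t : Shape X G} (h : s ≤ t) : s.fst ≤ t.fst := by
  cases h <;> first | exact bot_le | exact le_rfl | assumption

theorem snd_mono [PartialOrder G] {s t : Shape X G} (h : s ≤ t) : s.snd ≤ t.snd := by
  cases h <;> first | exact bot_le | exact le_rfl | assumption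

theorem fun_mono {s t : Shape X (X →o X)} (h : s ≤ t) : s.fnOf ≤ t.fnOf := by
  cases h <;> first | exact bot_le | exact le_rfl | assumption

theorem fst_map [PartialOrder G] [PartialOrder H] (f : X →o Y) (g : G →o H) (hf : f ⊥ = ⊥)
    (s : Shape X G) : (map f g s).fst = f s.fst := by
  cases s <;> first | rfl | exact hf.symm

theorem snd_map [PartialOrder G] [PartialOrder H] (f : X →o Y) (g : G →o H) (hf : f ⊥ = ⊥)
    (s : Shape X G) : (map f g s).snd = f s.snd := by
  cases s <;> first | rfl | exact hf.symm

theorem fun_map (f : X →o Y) (g : Y →o X) (hf : f ⊥ = ⊥)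
    (s : Shape X (X →o X)) (y : Y) : (map f (conj f g) s).fnOf y = f (s.fnOf (g y)) := by
  cases s <;> first | rfl | exact hf.symm

end Shape

namespace D

/-- First component, `⊥` if there is none. -/
def fst (d : D) : D where
  cut n := Shape.fst (d.cut (n + 1) : LvS n)
  coh n m h := by
    rw [← d.coh (n + 1) (m + 1) (by omega), tr_succ]
    exact (Shape.fst_map _ _ (tr_bot m n) _).symm

/-- Second component, `⊥` if there is none. -/
def snd (d : D) : D where
  cut n := Shape.snd (d.cut (n + 1) : LvS n)
  coh n m h := by
    rw [← d.coh (n + 1) (m + 1) (by omega), tr_succ]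
    exact (Shape.snd_map _ _ (tr_bot m n) _).symm

/-- The `n`-th approximation of the function component. -/
def fnc (d : D) (n : ℕ) : Lv n →o Lv n := Shape.fnOf (d.cut (n + 1) : LvS n)

theorem fnc_coh (d : D) {n m : ℕ} (h : n ≤ m) (x : Lv n) :
    tr m n (d.fnc m (tr n m x)) = d.fnc n x := by
  unfold fnc
  rw [← d.coh (n + 1) (m + 1) (by omega), tr_succ]
  exact (Shape.fun_map _ _ (tr_bot m n) _ _).symm

open Classical in
/-- The least upper bound of a set (`⊥` if there is none). -/
noncomputable def lub (S : Set D) : D := if h : ∃ a, IsLUB S a then h.choose else ⊥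

theorem isLUB_lub_range {c : ℕ → D} (hc : Monotone c) : IsLUB (Set.range c) (lub (Set.range c)) := by
  have h : ∃ a, IsLUB (Set.range c) a :=
    let ⟨a, ha, _⟩ := exists_isLUB (Set.range_nonempty c)
      (directedOn_range.2 (Monotone.directed_le hc))
    ⟨a, ha⟩
  rw [lub, dif_pos h]
  exact h.choose_spec

theorem attain_range {c : ℕ → D} (hc : Monotone c) (n : ℕ) :
    ∃ k, (c k).cut n = (lub (Set.range c)).cut n := by
  obtain ⟨_, ⟨k, rfl⟩, h⟩ := attain (Set.range_nonempty c)
      (directedOn_range.2 (Monotone.directed_le hc)) (isLUB_lub_range hc) n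
  exact ⟨k, h⟩

/-- Application of the function component, the supremum of its finite approximations. -/
noncomputable def app (d e : D) : D := lub (Set.range fun n => emb n (d.fnc n (e.cut n)))

theorem app_chain (d e : D) : Monotone fun n => emb n (d.fnc n (e.cut n)) := by
  intro n m h
  change emb n (d.fnc n (e.cut n)) ≤ emb m (d.fnc m (e.cut m))
  rw [← fnc_coh d h, ← emb_tr n m h]
  refine (emb m).monotone ((tr_le m n _).trans ((d.fnc m).monotone ?_))
  rw [← e.coh n m h]
  exact tr_le m n _

theorem app_le_app {d d' e e' : D} (h : d ≤ d') (k : e ≤ e') : app d e ≤ app d' e' := by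
  refine (isLUB_lub_range (app_chain d e)).2 ?_
  rintro _ ⟨n, rfl⟩
  refine le_trans ?_ ((isLUB_lub_range (app_chain d' e')).1 ⟨n, rfl⟩)
  exact (emb n).monotone ((Shape.fun_mono (h (n + 1)) _).trans ((d'.fnc n).monotone (k n)))

theorem app_emb (d : D) (n : ℕ) (x : Lv n) : (app d (emb n x)).cut n = d.fnc n x := by
  refine le_antisymm ?_ ?_
  · obtain ⟨k, hk⟩ := attain_range (app_chain d (emb n x)) n
    rw [app, ← hk]
    refine (app_chain d (emb n x) (le_max_left k n) n).trans ?_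
    change tr (max k n) n (d.fnc (max k n) (tr n (max k n) x)) ≤ _
    rw [fnc_coh d (le_max_right k n)]
  · have h : tr n n (d.fnc n (tr n n x)) ≤ (app d (emb n x)).cut n :=
      (isLUB_lub_range (app_chain d (emb n x))).1 ⟨n, rfl⟩ n
    rwa [tr_self, tr_self] at h

end D

section Scott

variable {α : Type} [Preorder α]

theorem scott_fst {f : α → D} (hf : ScottContinuous f) : ScottContinuous fun a => (f a).fst := by
  rw [scott_iff] at hf ⊢
  refine ⟨fun a b h n => Shape.fst_mono (hf.1 h (n + 1)), fun S hne hd a ha n => ?_⟩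
  obtain ⟨s, hs, e⟩ := hf.2 S hne hd a ha (n + 1)
  exact ⟨s, hs, congrArg (fun x : LvS n => x.fst) e⟩

theorem scott_snd {f : α → D} (hf : ScottContinuous f) : ScottContinuous fun a => (f a).snd := by
  rw [scott_iff] at hf ⊢
  refine ⟨fun a b h n => Shape.snd_mono (hf.1 h (n + 1)), fun S hne hd a ha n => ?_⟩
  obtain ⟨s, hs, e⟩ := hf.2 S hne hd a ha (n + 1)
  exact ⟨s, hs, congrArg (fun x : LvS n => x.snd) e⟩

/-- Criterion for Scott continuity in which the level may be attained from below only. -/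
theorem scott_of_le {f : α → D} (hm : Monotone f)
    (h : ∀ S : Set α, S.Nonempty → DirectedOn (· ≤ ·) S → ∀ a, IsLUB S a → ∀ n, ∃ s ∈ S,
      (f a).cut n ≤ (f s).cut n) : ScottContinuous f := by
  refine scott_iff.2 ⟨hm, fun S hne hd a ha n => ?_⟩
  obtain ⟨s, hs, e⟩ := h S hne hd a ha n
  exact ⟨s, hs, le_antisymm (hm (ha.1 hs) n) e⟩

theorem scott_app {f g : α → D} (hf : ScottContinuous f) (hg : ScottContinuous g) :
    ScottContinuous fun a => (f a).app (g a) := by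
  rw [scott_iff] at hf hg
  refine scott_of_le (fun a b h => D.app_le_app (hf.1 h) (hg.1 h)) fun S hne hd a ha n => ?_
  obtain ⟨k, hk⟩ := D.attain_range (D.app_chain (f a) (g a)) n
  obtain ⟨s, hs, e⟩ := hf.2 S hne hd a ha (k + 1)
  obtain ⟨t, ht, e'⟩ := hg.2 S hne hd a ha k
  obtain ⟨u, hu, hsu, htu⟩ := hd s hs t ht
  refine ⟨u, hu, ?_⟩
  rw [D.app, ← hk]
  refine le_trans ?_ ((D.isLUB_lub_range (D.app_chain (f u) (g u))).1 ⟨k, rfl⟩ n)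
  refine (D.emb k).monotone ?_ n
  rw [← e']
  refine le_trans ?_ (((f u).fnc k).monotone (hg.1 htu k))
  refine Shape.fun_mono ?_ _
  exact le_trans (le_of_eq e.symm) (hf.1 hsu (k + 1))

end Scott

namespace D

theorem scott_app_right (d : D) : ScottContinuous d.app :=
  scott_app (f := fun _ => d) (g := fun e => e) (ScottContinuous.const d) ScottContinuous.id

/-- The domain equation, from left to right. -/
noncomputable def unroll (d : D) : Shape D (SMap D D) :=
  match (d.cut 1 : LvS 0) with
  | .bot => .bot
  | .nil => .nil
  | .left _ => .left d.fst
  | .right _ => .right d.fst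
  | .pair _ _ => .pair d.fst d.snd
  | .amb _ _ => .amb d.fst d.snd
  | .fn _ => .fn ⟨d.app, scott_app_right d⟩

theorem roll_unroll (d : D) : roll (unroll d) = d := by
  refine D.ext (funext fun n => ?_)
  cases n with
  | zero => rfl
  | succ n =>
    have h : d.cut 1 = (Shape.map (tr n 0) (conj (tr n 0) (tr 0 n)) : LvS n →o LvS 0) (d.cut (n + 1)) := by
      rw [← d.coh 1 (n + 1) (by omega), tr_succ]
      rfl
    have hf : ∀ x, (app d (emb n x)).cut n = Shape.fnOf (d.cut (n + 1) : LvS n) x := app_emb d n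
    have h1 : d.fst.cut n = Shape.fst (d.cut (n + 1) : LvS n) := rfl
    have h2 : d.snd.cut n = Shape.snd (d.cut (n + 1) : LvS n) := rfl
    unfold unroll
    rw [h]
    generalize hx : (d.cut (n + 1) : LvS n) = x at *
    cases x with
    | bot => rfl
    | nil => rfl
    | left x => exact congrArg Shape.left h1
    | right x => exact congrArg Shape.right h1
    | pair x y => exact congrArg₂ Shape.pair h1 h2
    | amb x y => exact congrArg₂ Shape.amb h1 h2
    | fn g => exact congrArg Shape.fn (OrderHom.ext _ _ (funext hf))

theorem unroll_roll (s : Shape D (SMap D D)) : unroll (roll s) = s :=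
  le_antisymm (le_of_roll_le (roll_unroll _).le) (le_of_roll_le (roll_unroll _).ge)

/-- The domain equation. -/
noncomputable def equiv : Shape D (SMap D D) ≃o D where
  toFun := roll
  invFun := unroll
  left_inv := unroll_roll
  right_inv := roll_unroll
  map_rel_iff' := ⟨le_of_roll_le, fun h => roll_mono h⟩

end D

/-! ## Programs and their denotational semantics -/

/-- Extension of an environment by a value for a new variable, which gets index `0`. -/
def ext {X : Type} {n : ℕ} (η : Fin n → X) (d : X) : Fin (n + 1) → X := Fin.cons d η

/-- Programs with free variables among `n` variables, modulo renaming of bound variables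
(de Bruijn indices: index `0` is the innermost bound variable). Closed programs are `Prog 0`.
In a clause `C(a, b) → N` the variable `a` has index `1` and `b` has index `0` in `N`. -/
inductive Prog : ℕ → Type
  | var {n : ℕ} (i : Fin n) : Prog n
  | lam {n : ℕ} (M : Prog (n + 1)) : Prog n
  | app {n : ℕ} (M N : Prog n) : Prog n
  /-- strict application -/
  | sapp {n : ℕ} (M N : Prog n) : Prog n
  /-- the recursion operator -/
  | recur {n : ℕ} (M : Prog n) : Prog n
  | bot {n : ℕ} : Prog n
  | nil {n : ℕ} : Prog n
  | left {n : ℕ} (M : Prog n) : Prog n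
  | right {n : ℕ} (M : Prog n) : Prog n
  | pair {n : ℕ} (M N : Prog n) : Prog n
  | amb {n : ℕ} (M N : Prog n) : Prog n
  /-- `case M {Left(a) → L; Right(b) → R}` -/
  | caseSum {n : ℕ} (M : Prog n) (L R : Prog (n + 1)) : Prog n
  /-- `case M {Pair(a, b) → N}` -/
  | casePair {n : ℕ} (M : Prog n) (N : Prog (n + 2)) : Prog n
  /-- `case M {Amb(a, b) → N}` -/
  | caseAmb {n : ℕ} (M : Prog n) (N : Prog (n + 2)) : Prog n

/-- The semantic constructors. -/
def D.nil : D := D.roll .nil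
/-- `Left(a)` -/
def D.left (a : D) : D := D.roll (.left a)
/-- `Right(a)` -/
def D.right (a : D) : D := D.roll (.right a)
/-- `Pair(a, b)` -/
def D.pair (a b : D) : D := D.roll (.pair a b)
/-- `Amb(a, b)` -/
def D.amb (a b : D) : D := D.roll (.amb a b)
/-- `Fun(f)` -/
def D.fn (f : SMap D D) : D := D.roll (.fn f)

/-- The least fixed point of a continuous function, the supremum of the chain `fᵏ(⊥)`. -/
noncomputable def D.lfp (f : SMap D D) : D := D.lub (Set.range fun k : ℕ => f.1^[k] ⊥)

section Continuity

variable {α : Type} [Preorder α]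

theorem iterate_mono {f : D → D} (hf : Monotone f) : Monotone fun k : ℕ => f^[k] ⊥ :=
  hf.monotone_iterate_of_le_map bot_le

theorem D.isLeast_lfp (f : SMap D D) : IsLeast {d | f.1 d = d} (D.lfp f) := by
  have hc := iterate_mono f.2.monotone
  have hl := D.isLUB_lub_range hc
  refine ⟨le_antisymm ?_ ?_, fun d hd => hl.2 ?_⟩
  · refine (f.2 (Set.range_nonempty _) (directedOn_range.2 (Monotone.directed_le hc)) hl).2 ?_
    rintro _ ⟨_, ⟨k, rfl⟩, rfl⟩
    refine hl.1 ⟨k + 1, ?_⟩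
    exact Function.iterate_succ_apply' _ _ _
  · refine hl.2 ?_
    rintro _ ⟨k, rfl⟩
    refine (hc (Nat.le_succ k)).trans ?_
    change f.1^[k + 1] ⊥ ≤ _
    rw [Function.iterate_succ_apply']
    exact f.2.monotone (hl.1 ⟨k, rfl⟩)
  · rintro _ ⟨k, rfl⟩
    change f.1^[k] ⊥ ≤ d
    induction k with
    | zero => exact bot_le
    | succ k ih =>
      rw [Function.iterate_succ_apply', ← hd]
      exact f.2.monotone ih

theorem scott_pi {n : ℕ} {f : α → Fin n → D} (h : ∀ i, ScottContinuous fun a => f a i) :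
    ScottContinuous f := by
  intro S hne hd a ha
  rw [isLUB_pi]
  intro i
  rw [← Set.image_comp]
  exact h i hne hd ha

theorem scott_comp {β γ : Type} [Preorder β] [Preorder γ] {g : β → γ} {f : α → β}
    (hg : ScottContinuous g) (hf : ScottContinuous f) : ScottContinuous fun a => g (f a) :=
  hf.comp hg

theorem scott_proj {n : ℕ} (i : Fin n) : ScottContinuous fun η : Fin n → D => η i := by
  intro S _ _ a ha
  exact isLUB_pi.1 ha i

theorem scott_ext {n : ℕ} {f : α → Fin n → D} {g : α → D} (hf : ScottContinuous f)
    (hg : ScottContinuous g) : ScottContinuous fun a => ext (f a) (g a) := by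
  refine scott_pi fun i => ?_
  refine Fin.cases (motive := fun i => ScottContinuous fun a => ext (f a) (g a) i) hg (fun j => ?_) i
  exact scott_comp (g := fun η : Fin n → D => η j) (scott_proj j) hf

theorem flat_le {t t' : LvS 0} (h : Shape.Le t t') : t = .bot ∨ t = t' := by
  cases h <;> first
    | exact Or.inl rfl
    | exact Or.inr rfl
    | exact Or.inr (congrArg Shape.fn (OrderHom.ext _ _ (funext fun _ => rfl)))

/-- A case distinction on the outermost constructor is continuous. -/
theorem scott_tag {F : α → D} (hF : ScottContinuous F) {K : LvS 0 → α → D}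
    (h0 : ∀ a, K .bot a = ⊥) (hK : ∀ t, ScottContinuous (K t)) :
    ScottContinuous fun a => K ((F a).cut 1) a := by
  have hmono : Monotone fun a => K ((F a).cut 1) a := by
    intro a b hab
    change K ((F a).cut 1) a ≤ K ((F b).cut 1) b
    rcases flat_le (hF.monotone hab 1) with h | h
    · rw [h, h0]; exact bot_le
    · rw [h]; exact (hK _).monotone hab
  refine scott_of_le hmono fun S hne hd a ha n => ?_
  obtain ⟨s, hs, e⟩ := (scott_iff.1 hF).2 S hne hd a ha 1
  obtain ⟨t, ht, e'⟩ := (scott_iff.1 (hK ((F a).cut 1))).2 S hne hd a ha n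
  obtain ⟨u, hu, hsu, htu⟩ := hd s hs t ht
  refine ⟨u, hu, ?_⟩
  have e2 : (F u).cut 1 = (F a).cut 1 :=
    le_antisymm (hF.monotone (ha.1 hu) 1) (e.symm.le.trans (hF.monotone hsu 1))
  change _ ≤ (K ((F u).cut 1) u).cut n
  rw [e2, ← e']
  exact (hK _).monotone htu n

theorem scott_left {f : α → D} (hf : ScottContinuous f) :
    ScottContinuous fun a => D.left (f a) := by
  refine scott_of_le (fun a b h => D.roll_mono (Shape.Le.left (hf.monotone h)))
    fun S hne hd a ha n => ?_
  obtain ⟨s, hs, e⟩ := (scott_iff.1 hf).2 S hne hd a ha (n - 1)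
  refine ⟨s, hs, ?_⟩
  cases n with
  | zero => exact le_rfl
  | succ n => exact Shape.Le.left e.ge

theorem scott_right {f : α → D} (hf : ScottContinuous f) :
    ScottContinuous fun a => D.right (f a) := by
  refine scott_of_le (fun a b h => D.roll_mono (Shape.Le.right (hf.monotone h)))
    fun S hne hd a ha n => ?_
  obtain ⟨s, hs, e⟩ := (scott_iff.1 hf).2 S hne hd a ha (n - 1)
  refine ⟨s, hs, ?_⟩
  cases n with
  | zero => exact le_rfl
  | succ n => exact Shape.Le.right e.ge

theorem scott_pair {f g : α → D} (hf : ScottContinuous f) (hg : ScottContinuous g) :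
    ScottContinuous fun a => D.pair (f a) (g a) := by
  refine scott_of_le (fun a b h => D.roll_mono (Shape.Le.pair (hf.monotone h) (hg.monotone h)))
    fun S hne hd a ha n => ?_
  obtain ⟨s, hs, e⟩ := (scott_iff.1 hf).2 S hne hd a ha (n - 1)
  obtain ⟨t, ht, e'⟩ := (scott_iff.1 hg).2 S hne hd a ha (n - 1)
  obtain ⟨u, hu, hsu, htu⟩ := hd s hs t ht
  refine ⟨u, hu, ?_⟩
  cases n with
  | zero => exact le_rfl
  | succ n =>
    exact Shape.Le.pair (e.ge.trans (hf.monotone hsu n)) (e'.ge.trans (hg.monotone htu n))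

theorem scott_amb {f g : α → D} (hf : ScottContinuous f) (hg : ScottContinuous g) :
    ScottContinuous fun a => D.amb (f a) (g a) := by
  refine scott_of_le (fun a b h => D.roll_mono (Shape.Le.amb (hf.monotone h) (hg.monotone h)))
    fun S hne hd a ha n => ?_
  obtain ⟨s, hs, e⟩ := (scott_iff.1 hf).2 S hne hd a ha (n - 1)
  obtain ⟨t, ht, e'⟩ := (scott_iff.1 hg).2 S hne hd a ha (n - 1)
  obtain ⟨u, hu, hsu, htu⟩ := hd s hs t ht
  refine ⟨u, hu, ?_⟩
  cases n with
  | zero => exact le_rfl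
  | succ n =>
    exact Shape.Le.amb (e.ge.trans (hf.monotone hsu n)) (e'.ge.trans (hg.monotone htu n))

theorem scott_ext_right {n : ℕ} (F : SMap (Fin (n + 1) → D) D) (η : Fin n → D) :
    ScottContinuous fun d => F.1 (ext η d) :=
  scott_comp F.2 (scott_ext (ScottContinuous.const η) ScottContinuous.id)

theorem scott_lam {n : ℕ} (F : SMap (Fin (n + 1) → D) D) :
    ScottContinuous fun η => D.fn ⟨fun d => F.1 (ext η d), scott_ext_right F η⟩ := by
  have hF : ∀ d, ScottContinuous fun η : Fin n → D => F.1 (ext η d) := fun d =>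
    scott_comp F.2 (scott_ext ScottContinuous.id (ScottContinuous.const d))
  refine scott_of_le (fun a b h => D.roll_mono (Shape.Le.fn fun d => (hF d).monotone h))
    fun S hne hd a ha n => ?_
  cases n with
  | zero =>
    obtain ⟨s, hs⟩ := hne
    exact ⟨s, hs, le_rfl⟩
  | succ n =>
    choose s hs e using fun x : Lv n => (scott_iff.1 (hF (D.emb n x))).2 S hne hd a ha n
    have : Nonempty S := hne.to_subtype
    obtain ⟨u, hu⟩ := (directedOn_iff_directed.1 hd).finite_le fun x => (⟨s x, hs x⟩ : S)
    refine ⟨u.1, u.2, Shape.Le.fn fun x => ?_⟩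
    exact (e x).ge.trans ((hF (D.emb n x)).monotone (hu x) n)

theorem scott_lub_iterate {f : α → D} (hf : ScottContinuous f) :
    ScottContinuous fun a => D.lub (Set.range fun k : ℕ => (f a).app^[k] ⊥) := by
  have hi : ∀ k : ℕ, ScottContinuous fun a => (f a).app^[k] ⊥ := by
    intro k
    induction k with
    | zero => exact ScottContinuous.const _
    | succ k ih =>
      simp only [Function.iterate_succ_apply']
      exact scott_app hf ih
  have hc : ∀ a, Monotone fun k : ℕ => (f a).app^[k] ⊥ := fun a =>
    iterate_mono (D.scott_app_right _).monotone
  refine scott_of_le (fun a b h => ?_) fun S hne hd a ha n => ?_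
  · refine (D.isLUB_lub_range (hc a)).2 ?_
    rintro _ ⟨k, rfl⟩
    exact ((hi k).monotone h).trans ((D.isLUB_lub_range (hc b)).1 ⟨k, rfl⟩)
  · obtain ⟨k, hk⟩ := D.attain_range (hc a) n
    obtain ⟨s, hs, e⟩ := (scott_iff.1 (hi k)).2 S hne hd a ha n
    refine ⟨s, hs, ?_⟩
    rw [← hk, ← e]
    exact (D.isLUB_lub_range (hc s)).1 ⟨k, rfl⟩ n

/-- Semantics of `M N`. -/
noncomputable def appVal (x y : D) : D :=
  match D.unroll x with
  | .fn f => f.1 y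
  | _ => ⊥

open Classical in
/-- Semantics of strict application. -/
noncomputable def sappVal (x y : D) : D :=
  match D.unroll x with
  | .fn f => if y = ⊥ then ⊥ else f.1 y
  | _ => ⊥

/-- Semantics of the recursion operator. -/
noncomputable def recVal (x : D) : D :=
  match D.unroll x with
  | .fn f => D.lfp f
  | _ => ⊥

/-- Semantics of `case _ {Left(a) → L; Right(b) → R}`. -/
noncomputable def caseSumVal (x : D) (L R : D → D) : D :=
  match D.unroll x with
  | .left a => L a
  | .right b => R b
  | _ => ⊥

/-- Semantics of `case _ {Pair(a, b) → N}`. -/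
noncomputable def casePairVal (x : D) (N : D → D → D) : D :=
  match D.unroll x with
  | .pair a b => N a b
  | _ => ⊥

/-- Semantics of `case _ {Amb(a, b) → N}`. -/
noncomputable def caseAmbVal (x : D) (N : D → D → D) : D :=
  match D.unroll x with
  | .amb a b => N a b
  | _ => ⊥

theorem scott_appVal {f g : α → D} (hf : ScottContinuous f) (hg : ScottContinuous g) :
    ScottContinuous fun a => appVal (f a) (g a) := by
  have h := scott_tag hf (K := fun t a => match t with
    | .fn _ => (f a).app (g a)
    | _ => ⊥) (fun _ => rfl) (fun t => by
      cases t <;> first | exact ScottContinuous.const _ | exact scott_app hf hg)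
  convert h using 2 with a
  unfold appVal D.unroll
  generalize (f a).cut 1 = t
  cases (t : LvS 0) <;> rfl

theorem cut_one_eq_bot {d : D} : (d.cut 1 : LvS 0) = .bot ↔ d = ⊥ := by
  refine ⟨fun h => ?_, fun h => by rw [h]; rfl⟩
  rw [← D.roll_unroll d]
  unfold D.unroll
  rw [h]
  exact le_antisymm (fun n => by cases n <;> exact le_rfl) bot_le

theorem scott_sappVal {f g : α → D} (hf : ScottContinuous f) (hg : ScottContinuous g) :
    ScottContinuous fun a => sappVal (f a) (g a) := by
  have h := scott_tag hg (K := fun t a => match t with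
    | .bot => ⊥
    | _ => appVal (f a) (g a)) (fun _ => rfl) (fun t => by
      cases t <;> first | exact ScottContinuous.const _ | exact scott_appVal hf hg)
  convert h using 2 with a
  have hb := cut_one_eq_bot (d := g a)
  unfold sappVal appVal
  generalize ((g a).cut 1 : LvS 0) = t at *
  by_cases hg0 : g a = ⊥
  · rw [hb.2 hg0, hg0]
    simp only [if_true]
    cases (f a).unroll <;> rfl
  · simp only [if_neg hg0]
    cases t <;> first | exact absurd (hb.1 rfl) hg0 | rfl

theorem scott_recVal {f : α → D} (hf : ScottContinuous f) :
    ScottContinuous fun a => recVal (f a) := by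
  have h := scott_tag hf (K := fun t a => match t with
    | .fn _ => D.lub (Set.range fun k : ℕ => (f a).app^[k] ⊥)
    | _ => ⊥) (fun _ => rfl) (fun t => by
      cases t <;> first | exact ScottContinuous.const _ | exact scott_lub_iterate hf)
  convert h using 2 with a
  unfold recVal D.unroll
  generalize (f a).cut 1 = t
  cases (t : LvS 0) <;> rfl

theorem scott_caseSum {n : ℕ} {f : (Fin n → D) → D} (hf : ScottContinuous f)
    (L R : SMap (Fin (n + 1) → D) D) :
    ScottContinuous fun η =>
      caseSumVal (f η) (fun a => L.1 (ext η a)) (fun b => R.1 (ext η b)) := by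
  have hL := scott_comp L.2 (scott_ext ScottContinuous.id (scott_fst hf))
  have hR := scott_comp R.2 (scott_ext ScottContinuous.id (scott_fst hf))
  have h := scott_tag hf (K := fun t η => match t with
    | .left _ => L.1 (ext η (f η).fst)
    | .right _ => R.1 (ext η (f η).fst)
    | _ => ⊥) (fun _ => rfl) (fun t => by
      cases t <;> first | exact ScottContinuous.const _ | exact hL | exact hR)
  convert h using 2 with η
  unfold caseSumVal D.unroll
  generalize (f η).cut 1 = t
  cases (t : LvS 0) <;> rfl

theorem scott_casePair {n : ℕ} {f : (Fin n → D) → D} (hf : ScottContinuous f)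
    (N : SMap (Fin (n + 2) → D) D) :
    ScottContinuous fun η => casePairVal (f η) (fun a b => N.1 (ext (ext η a) b)) := by
  have hN := scott_comp N.2 (scott_ext (scott_ext ScottContinuous.id (scott_fst hf)) (scott_snd hf))
  have h := scott_tag hf (K := fun t η => match t with
    | .pair _ _ => N.1 (ext (ext η (f η).fst) (f η).snd)
    | _ => ⊥) (fun _ => rfl) (fun t => by
      cases t <;> first | exact ScottContinuous.const _ | exact hN)
  convert h using 2 with η
  unfold casePairVal D.unroll
  generalize (f η).cut 1 = t
  cases (t : LvS 0) <;> rfl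

theorem scott_caseAmb {n : ℕ} {f : (Fin n → D) → D} (hf : ScottContinuous f)
    (N : SMap (Fin (n + 2) → D) D) :
    ScottContinuous fun η => caseAmbVal (f η) (fun a b => N.1 (ext (ext η a) b)) := by
  have hN := scott_comp N.2 (scott_ext (scott_ext ScottContinuous.id (scott_fst hf)) (scott_snd hf))
  have h := scott_tag hf (K := fun t η => match t with
    | .amb _ _ => N.1 (ext (ext η (f η).fst) (f η).snd)
    | _ => ⊥) (fun _ => rfl) (fun t => by
      cases t <;> first | exact ScottContinuous.const _ | exact hN)
  convert h using 2 with η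
  unfold caseAmbVal D.unroll
  generalize (f η).cut 1 = t
  cases (t : LvS 0) <;> rfl

end Continuity

/-- Denotational semantics of programs, as continuous functions of the environment. -/
noncomputable def den : {n : ℕ} → Prog n → SMap (Fin n → D) D
  | _, .var i => ⟨fun η => η i, scott_proj i⟩
  | _, .lam M => ⟨fun η => D.fn ⟨fun d => (den M).1 (ext η d), scott_ext_right (den M) η⟩,
      scott_lam (den M)⟩
  | _, .app M N => ⟨fun η => appVal ((den M).1 η) ((den N).1 η), scott_appVal (den M).2 (den N).2⟩
  | _, .sapp M N => ⟨fun η => sappVal ((den M).1 η) ((den N).1 η),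
      scott_sappVal (den M).2 (den N).2⟩
  | _, .recur M => ⟨fun η => recVal ((den M).1 η), scott_recVal (den M).2⟩
  | _, .bot => ⟨fun _ => ⊥, ScottContinuous.const ⊥⟩
  | _, .nil => ⟨fun _ => D.nil, ScottContinuous.const D.nil⟩
  | _, .left M => ⟨fun η => D.left ((den M).1 η), scott_left (den M).2⟩
  | _, .right M => ⟨fun η => D.right ((den M).1 η), scott_right (den M).2⟩
  | _, .pair M N => ⟨fun η => D.pair ((den M).1 η) ((den N).1 η), scott_pair (den M).2 (den N).2⟩
  | _, .amb M N => ⟨fun η => D.amb ((den M).1 η) ((den N).1 η), scott_amb (den M).2 (den N).2⟩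
  | _, .caseSum M L R =>
    ⟨fun η => caseSumVal ((den M).1 η) (fun a => (den L).1 (ext η a)) (fun b => (den R).1 (ext η b)),
      scott_caseSum (den M).2 (den L) (den R)⟩
  | _, .casePair M N =>
    ⟨fun η => casePairVal ((den M).1 η) (fun a b => (den N).1 (ext (ext η a) b)),
      scott_casePair (den M).2 (den N)⟩
  | _, .caseAmb M N =>
    ⟨fun η => caseAmbVal ((den M).1 η) (fun a b => (den N).1 (ext (ext η a) b)),
      scott_caseAmb (den M).2 (den N)⟩

/-- The denotation of a closed program. -/
noncomputable def val (M : Prog 0) : D := (den M).1 Fin.elim0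

/-! ## The choice semantics `data` -/

/-- The operator whose largest fixed point is the relation `d ∈ data(a)`. -/
def DataStep (R : D → D → Prop) (a d : D) : Prop :=
  (∃ a' b', a = D.amb a' b' ∧ a' ≠ ⊥ ∧ R a' d) ∨
  (∃ a' b', a = D.amb a' b' ∧ b' ≠ ⊥ ∧ R b' d) ∨
  (a = D.amb ⊥ ⊥ ∧ d = ⊥) ∨
  (a = D.nil ∧ d = D.nil) ∨
  (∃ a' d', a = D.left a' ∧ d = D.left d' ∧ R a' d') ∨
  (∃ a' d', a = D.right a' ∧ d = D.right d' ∧ R a' d') ∨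
  (∃ a₁ a₂ d₁ d₂, a = D.pair a₁ a₂ ∧ d = D.pair d₁ d₂ ∧ R a₁ d₁ ∧ R a₂ d₂) ∨
  (∃ f, a = D.fn f ∧ d = a) ∨
  (a = ⊥ ∧ d = ⊥)

/-- The set `data(a)`: the relation `d ∈ data(a)` is the largest `R` with `R = DataStep R`,
equivalently the union of all `R` with `R ⊆ DataStep R`. -/
def data (a : D) : Set D :=
  {d | ∃ R : D → D → Prop, (∀ x y, R x y → DataStep R x y) ∧ R a d}

/-! ## Types -/

/-- Types with free type variables among `n` variables (de Bruijn indices). Closed types are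
`Ty 0`. -/
inductive Ty : ℕ → Type
  | var {n : ℕ} (i : Fin n) : Ty n
  | one {n : ℕ} : Ty n
  | prod {n : ℕ} (ρ σ : Ty n) : Ty n
  | sum {n : ℕ} (ρ σ : Ty n) : Ty n
  | arrow {n : ℕ} (ρ σ : Ty n) : Ty n
  | fix {n : ℕ} (ρ : Ty (n + 1)) : Ty n
  | amb {n : ℕ} (ρ : Ty n) : Ty n

namespace Ty

/-- The type variable `i` occurs free. -/
def Occurs : {n : ℕ} → Fin n → Ty n → Prop
  | _, i, .var j => i = j
  | _, _, .one => False
  | _, i, .prod ρ σ => Occurs i ρ ∨ Occurs i σ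
  | _, i, .sum ρ σ => Occurs i ρ ∨ Occurs i σ
  | _, i, .arrow ρ σ => Occurs i ρ ∨ Occurs i σ
  | _, i, .fix ρ => Occurs i.succ ρ
  | _, i, .amb ρ => Occurs i ρ

/-- The type variable `i` has no free occurrence in the left side of a function type. -/
def NotLeft : {n : ℕ} → Fin n → Ty n → Prop
  | _, _, .var _ => True
  | _, _, .one => True
  | _, i, .prod ρ σ => NotLeft i ρ ∧ NotLeft i σ
  | _, i, .sum ρ σ => NotLeft i ρ ∧ NotLeft i σ
  | _, i, .arrow ρ σ => ¬ Occurs i ρ ∧ NotLeft i σ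
  | _, i, .fix ρ => NotLeft i.succ ρ
  | _, i, .amb ρ => NotLeft i ρ

/-- Properly strictly positive in the type variable `i`. -/
def ProperlyStrictlyPositive {n : ℕ} (i : Fin n) (ρ : Ty n) : Prop :=
  Occurs i ρ ∧ ρ ≠ .var i ∧ NotLeft i ρ

/-- Determined types: `fix α₁ … fix αₙ ρ` with `ρ` of the form `1`, `ρ₁ × ρ₂`, `ρ₁ + ρ₂` or
`ρ₁ ⇒ ρ₂`. -/
inductive Determined : {n : ℕ} → Ty n → Prop
  | one {n : ℕ} : Determined (.one : Ty n)
  | prod {n : ℕ} (ρ σ : Ty n) : Determined (.prod ρ σ)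
  | sum {n : ℕ} (ρ σ : Ty n) : Determined (.sum ρ σ)
  | arrow {n : ℕ} (ρ σ : Ty n) : Determined (.arrow ρ σ)
  | fix {n : ℕ} {ρ : Ty (n + 1)} (h : Determined ρ) : Determined (.fix ρ)

/-- Regular types. -/
def Regular : {n : ℕ} → Ty n → Prop
  | _, .var _ => True
  | _, .one => True
  | _, .prod ρ σ => Regular ρ ∧ Regular σ
  | _, .sum ρ σ => Regular ρ ∧ Regular σ
  | _, .arrow ρ σ => Regular ρ ∧ Regular σ
  | _, .fix ρ => ProperlyStrictlyPositive 0 ρ ∧ Regular ρ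
  | _, .amb ρ => Determined ρ ∧ Regular ρ

end Ty

/-- Subdomains of `D`: downward closed and closed under suprema of bounded subsets. (A subset is
bounded iff it has a supremum, since `D` is bounded complete; the empty subset gives `⊥ ∈ X`.) -/
def IsSubdomain (X : Set D) : Prop :=
  IsLowerSet X ∧ ∀ S ⊆ X, ∀ a, IsLUB S a → a ∈ X

/-- Denotational semantics of types. -/
def tden : {n : ℕ} → Ty n → (Fin n → Set D) → Set D
  | _, .var i, ζ => ζ i
  | _, .one, _ => {D.nil, ⊥}
  | _, .prod ρ σ, ζ => {x | ∃ a ∈ tden ρ ζ, ∃ b ∈ tden σ ζ, x = D.pair a b} ∪ {⊥}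
  | _, .sum ρ σ, ζ =>
    ({x | ∃ a ∈ tden ρ ζ, x = D.left a} ∪ {x | ∃ b ∈ tden σ ζ, x = D.right b}) ∪ {⊥}
  | _, .arrow ρ σ, ζ =>
    {x | ∃ f : SMap D D, (∀ a ∈ tden ρ ζ, f.1 a ∈ tden σ ζ) ∧ x = D.fn f} ∪ {⊥}
  | _, .fix ρ, ζ => ⋂₀ {X | IsSubdomain X ∧ tden ρ (ext ζ X) ⊆ X}
  | _, .amb ρ, ζ => {x | ∃ a ∈ tden ρ ζ, ∃ b ∈ tden ρ ζ, x = D.amb a b} ∪ {⊥}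

/-- The denotation of a closed type. -/
def tval (ρ : Ty 0) : Set D := tden ρ Fin.elim0

/-! ## Operational semantics -/

namespace Prog

/-- Renaming of free variables. -/
def rename : {n m : ℕ} → (Fin n → Fin m) → Prog n → Prog m
  | _, _, r, .var i => .var (r i)
  | _, _, r, .lam M => .lam (rename (ext (Fin.succ ∘ r) 0) M)
  | _, _, r, .app M N => .app (rename r M) (rename r N)
  | _, _, r, .sapp M N => .sapp (rename r M) (rename r N)
  | _, _, r, .recur M => .recur (rename r M)
  | _, _, _, .bot => .bot
  | _, _, _, .nil => .nil
  | _, _, r, .left M => .left (rename r M)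
  | _, _, r, .right M => .right (rename r M)
  | _, _, r, .pair M N => .pair (rename r M) (rename r N)
  | _, _, r, .amb M N => .amb (rename r M) (rename r N)
  | _, _, r, .caseSum M L R => .caseSum (rename r M) (rename (ext (Fin.succ ∘ r) 0) L)
      (rename (ext (Fin.succ ∘ r) 0) R)
  | _, _, r, .casePair M N => .casePair (rename r M)
      (rename (ext (Fin.succ ∘ ext (Fin.succ ∘ r) 0) 0) N)
  | _, _, r, .caseAmb M N => .caseAmb (rename r M)
      (rename (ext (Fin.succ ∘ ext (Fin.succ ∘ r) 0) 0) N)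

/-- A substitution, moved under a binder. -/
def lift {n m : ℕ} (s : Fin n → Prog m) : Fin (n + 1) → Prog (m + 1) :=
  ext (fun i => rename Fin.succ (s i)) (.var 0)

/-- Simultaneous capture-avoiding substitution. -/
def subst : {n m : ℕ} → (Fin n → Prog m) → Prog n → Prog m
  | _, _, s, .var i => s i
  | _, _, s, .lam M => .lam (subst (lift s) M)
  | _, _, s, .app M N => .app (subst s M) (subst s N)
  | _, _, s, .sapp M N => .sapp (subst s M) (subst s N)
  | _, _, s, .recur M => .recur (subst s M)
  | _, _, _, .bot => .bot
  | _, _, _, .nil => .nil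
  | _, _, s, .left M => .left (subst s M)
  | _, _, s, .right M => .right (subst s M)
  | _, _, s, .pair M N => .pair (subst s M) (subst s N)
  | _, _, s, .amb M N => .amb (subst s M) (subst s N)
  | _, _, s, .caseSum M L R => .caseSum (subst s M) (subst (lift s) L) (subst (lift s) R)
  | _, _, s, .casePair M N => .casePair (subst s M) (subst (lift (lift s)) N)
  | _, _, s, .caseAmb M N => .caseAmb (subst s M) (subst (lift (lift s)) N)

/-- `M[N/a]`, where `a` is the last bound variable. -/
def inst {n : ℕ} (M : Prog (n + 1)) (N : Prog n) : Prog n := subst (ext .var N) M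

/-- `K[M/a, N/b]`, where `a, b` are the last two bound variables. -/
def inst₂ {n : ℕ} (K : Prog (n + 2)) (M N : Prog n) : Prog n := subst (ext (ext .var M) N) K

/-- Programs that begin with a constructor (including `Amb`). -/
inductive IsCon {n : ℕ} : Prog n → Prop
  | nil : IsCon .nil
  | left (M : Prog n) : IsCon (.left M)
  | right (M : Prog n) : IsCon (.right M)
  | pair (M N : Prog n) : IsCon (.pair M N)
  | amb (M N : Prog n) : IsCon (.amb M N)

/-- Weak head normal forms. -/
inductive Whnf {n : ℕ} : Prog n → Prop
  | con {M : Prog n} (h : IsCon M) : Whnf M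
  | lam (M : Prog (n + 1)) : Whnf (.lam M)

/-- `⊥`-like programs. -/
inductive BotLike {n : ℕ} : Prog n → Prop
  | bot : BotLike .bot
  | app {M : Prog n} (h : IsCon M) (N : Prog n) : BotLike (.app M N)
  | sapp {M : Prog n} (h : IsCon M) (N : Prog n) : BotLike (.sapp M N)
  | caseSum {M : Prog n} (h : Whnf M) (hl : ∀ K, M ≠ .left K) (hr : ∀ K, M ≠ .right K)
      (L R : Prog (n + 1)) : BotLike (.caseSum M L R)
  | casePair {M : Prog n} (h : Whnf M) (hp : ∀ K L, M ≠ .pair K L)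
      (N : Prog (n + 2)) : BotLike (.casePair M N)
  | caseAmb {M : Prog n} (h : Whnf M) (ha : ∀ K L, M ≠ .amb K L)
      (N : Prog (n + 2)) : BotLike (.caseAmb M N)

/-- The leftmost-outermost small-step reduction `⇝` to weak head normal form. -/
inductive Red {n : ℕ} : Prog n → Prog n → Prop
  | beta (M : Prog (n + 1)) (N : Prog n) : Red (.app (.lam M) N) (M.inst N)
  | app {M M' : Prog n} (h : Red M M') (N : Prog n) : Red (.app M N) (.app M' N)
  | sbeta (M : Prog (n + 1)) {N : Prog n} (hN : Whnf N) : Red (.sapp (.lam M) N) (M.inst N)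
  | sappFun {M M' N : Prog n} (hN : Whnf N) (h : Red M M') : Red (.sapp M N) (.sapp M' N)
  | sappArg (M : Prog n) {N N' : Prog n} (h : Red N N') : Red (.sapp M N) (.sapp M N')
  | recur (M : Prog n) : Red (.recur M) (.app M (.recur M))
  | caseLeft (M : Prog n) (L R : Prog (n + 1)) : Red (.caseSum (.left M) L R) (L.inst M)
  | caseRight (M : Prog n) (L R : Prog (n + 1)) : Red (.caseSum (.right M) L R) (R.inst M)
  | casePair (M₁ M₂ : Prog n) (N : Prog (n + 2)) :
      Red (.casePair (.pair M₁ M₂) N) (N.inst₂ M₁ M₂)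
  | caseAmb (M₁ M₂ : Prog n) (N : Prog (n + 2)) : Red (.caseAmb (.amb M₁ M₂) N) (N.inst₂ M₁ M₂)
  | caseSumArg {M M' : Prog n} (h : Red M M') (L R : Prog (n + 1)) :
      Red (.caseSum M L R) (.caseSum M' L R)
  | casePairArg {M M' : Prog n} (h : Red M M') (N : Prog (n + 2)) :
      Red (.casePair M N) (.casePair M' N)
  | caseAmbArg {M M' : Prog n} (h : Red M M') (N : Prog (n + 2)) :
      Red (.caseAmb M N) (.caseAmb M' N)
  | botLike {M : Prog n} (h : BotLike M) : Red M .bot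

/-- Names of the rules that derive a choice step. -/
inductive ChoiceRule : Type
  /-- a `⇝`-step -/
  | head
  /-- a `⇝`-step of the left argument of `Amb` -/
  | redLeft
  /-- a `⇝`-step of the right argument of `Amb` -/
  | redRight
  /-- choosing the left argument of `Amb` -/
  | pickLeft
  /-- choosing the right argument of `Amb` -/
  | pickRight

/-- The choice reduction, annotated with the rule that derives the step. -/
inductive ChoiceStep {n : ℕ} : ChoiceRule → Prog n → Prog n → Prop
  | head {M M' : Prog n} (h : Red M M') : ChoiceStep .head M M'
  | redLeft {L L' : Prog n} (h : Red L L') (R : Prog n) :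
      ChoiceStep .redLeft (.amb L R) (.amb L' R)
  | redRight (L : Prog n) {R R' : Prog n} (h : Red R R') :
      ChoiceStep .redRight (.amb L R) (.amb L R')
  | pickLeft {L : Prog n} (h : Whnf L) (R : Prog n) : ChoiceStep .pickLeft (.amb L R) L
  | pickRight (L : Prog n) {R : Prog n} (h : Whnf R) : ChoiceStep .pickRight (.amb L R) R

/-- The shape of the derivation of a parallel step: which rules are used, and where. -/
inductive ParRule : Type
  | choice (c : ChoiceRule)
  | nil
  | left (r : ParRule)
  | right (r : ParRule)
  | pair (r s : ParRule)
  | lam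

/-- The parallel reduction, annotated with the shape of the derivation of the step.
`M` reduces to `M'` iff `ParStep r M M'` for some `r`. -/
inductive ParStep {n : ℕ} : ParRule → Prog n → Prog n → Prop
  | choice {c : ChoiceRule} {M M' : Prog n} (h : ChoiceStep c M M') : ParStep (.choice c) M M'
  | nil : ParStep .nil .nil .nil
  | left {r : ParRule} {M M' : Prog n} (h : ParStep r M M') :
      ParStep (.left r) (.left M) (.left M')
  | right {r : ParRule} {M M' : Prog n} (h : ParStep r M M') :
      ParStep (.right r) (.right M) (.right M')
  | pair {r s : ParRule} {M M' N N' : Prog n} (h : ParStep r M M') (k : ParStep s N N') :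
      ParStep (.pair r s) (.pair M N) (.pair M' N')
  | lam (M : Prog (n + 1)) : ParStep .lam (.lam M) (.lam M)

/-- Unfair infinite reduction sequences `M 0, M 1, …`, where `r i` describes the step from `M i` to
`M (i + 1)`: from some point on and somewhere below data constructors, only one side of an `Amb`
is reduced. Recording the rules matters when a program such as `Amb(⊥, ⊥)` reduces to itself, on
the left as well as on the right. -/
inductive Unfair : (ℕ → Prog 0) → (ℕ → ParRule) → Prop
  | ambLeft {M : ℕ → Prog 0} {r : ℕ → ParRule} (L : ℕ → Prog 0) (R : Prog 0)
      (hM : ∀ i, M i = .amb (L i) R) (hL : ∀ i, Red (L i) (L (i + 1)))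
      (hr : ∀ i, r i = .choice .redLeft) : Unfair M r
  | ambRight {M : ℕ → Prog 0} {r : ℕ → ParRule} (L : Prog 0) (R : ℕ → Prog 0)
      (hM : ∀ i, M i = .amb L (R i)) (hR : ∀ i, Red (R i) (R (i + 1)))
      (hr : ∀ i, r i = .choice .redRight) : Unfair M r
  | left {M : ℕ → Prog 0} {r : ℕ → ParRule} (N : ℕ → Prog 0) (s : ℕ → ParRule)
      (hM : ∀ i, M i = .left (N i)) (hr : ∀ i, r i = .left (s i)) (h : Unfair N s) : Unfair M r
  | right {M : ℕ → Prog 0} {r : ℕ → ParRule} (N : ℕ → Prog 0) (s : ℕ → ParRule)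
      (hM : ∀ i, M i = .right (N i)) (hr : ∀ i, r i = .right (s i)) (h : Unfair N s) : Unfair M r
  | pairFst {M : ℕ → Prog 0} {r : ℕ → ParRule} (N₁ N₂ : ℕ → Prog 0) (s₁ s₂ : ℕ → ParRule)
      (hM : ∀ i, M i = .pair (N₁ i) (N₂ i)) (hr : ∀ i, r i = .pair (s₁ i) (s₂ i))
      (h : Unfair N₁ s₁) : Unfair M r
  | pairSnd {M : ℕ → Prog 0} {r : ℕ → ParRule} (N₁ N₂ : ℕ → Prog 0) (s₁ s₂ : ℕ → ParRule)
      (hM : ∀ i, M i = .pair (N₁ i) (N₂ i)) (hr : ∀ i, r i = .pair (s₁ i) (s₂ i))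
      (h : Unfair N₂ s₂) : Unfair M r
  | tail {M : ℕ → Prog 0} {r : ℕ → ParRule}
      (h : Unfair (fun i => M (i + 1)) (fun i => r (i + 1))) : Unfair M r

/-- `P 0, P 1, …` with steps described by `r` is a computation of `M`: an infinite fair reduction
sequence that starts with `M`. -/
def IsComputation (M : Prog 0) (P : ℕ → Prog 0) (r : ℕ → ParRule) : Prop :=
  P 0 = M ∧ (∀ i, ParStep (r i) (P i) (P (i + 1))) ∧ ¬ Unfair P r

end Prog

/-- The part `M_D` of a program that has been evaluated to a data, in an environment. -/
noncomputable def obsEnv : {n : ℕ} → Prog n → (Fin n → D) → D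
  | _, .nil, _ => D.nil
  | _, .left M, η => D.left (obsEnv M η)
  | _, .right M, η => D.right (obsEnv M η)
  | _, .pair M N, η => D.pair (obsEnv M η) (obsEnv N η)
  | _, .lam M, η => (den (.lam M)).1 η
  | _, _, _ => ⊥

/-- The part `M_D` of a closed program that has been evaluated to a data. -/
noncomputable def obs (M : Prog 0) : D := obsEnv M Fin.elim0

end AmbLang

namespace AmbLang

/-! Given `d` in the data of the value of `M`, the computation is produced by a strategy that knows
`d`. A program that is not a w.h.n.f. is reduced along a shortest path to one, if its value is not
`⊥`, and arbitrarily otherwise; below data constructors all arguments are treated in parallel, each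
with its own component of `d`. At `Amb(L, R)` the strategy works on `L` alone if the value of `L` is
not `⊥` and has `d` among its data (`Eligible`), otherwise on `R` alone under the same condition;
the chosen side is picked once it is a w.h.n.f. The definition of data leaves one more case, in
which both values and `d` are `⊥`, and then the sides are reduced in turn, according to the parity
of the time. The invariant `Goal` keeps `d` attainable all along (`Goal.strat`).

One-sided work cannot last forever. An eligible side has a value other than `⊥`, so by adequacy
(`exists_steps_whnf`) it has a w.h.n.f., and along a shortest path the distance to it decreases
(`val_eq_bot_of_forall_toward`). If the value is `⊥`, the alternation prevents one-sidedness. Hence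
every run of the strategy is fair (`Run.not_unfair`). Adequacy itself is proved by a logical
relation between the finite approximations of `D` and closed programs; recursion on the level makes
the relation well defined in spite of the function spaces.

Regularity of the type guarantees productivity. Data is a largest relation, so if `a = Amb(a, a)`
then every `d` is in the data of `a`, although endless choosing produces nothing. The value of a
member of a regular type is `tame`: arguments of `Amb` never begin with `Amb` themselves. So one
choice is enough to reach a data constructor or a function. The observed part of a run never exceeds
`d` (`Goal.obs_le`), and by induction on `n` it eventually reaches the `n`-th approximation of `d`
(`Run.exists_cut_le`); together these say that its supremum is `d`. -/

@[simp] theorem ext_zero {X : Type} {n : ℕ} (η : Fin n → X) (d : X) : ext η d 0 = d := rfl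

@[simp] theorem ext_succ {X : Type} {n : ℕ} (η : Fin n → X) (d : X) (i : Fin n) :
    ext η d i.succ = η i := rfl

theorem ext_under {X : Type} {n m : ℕ} (r : Fin n → Fin m) (η : Fin m → X) (d : X) :
    (fun i => ext η d (ext (Fin.succ ∘ r) 0 i)) = ext (fun i => η (r i)) d :=
  funext fun i => Fin.cases rfl (fun _ => rfl) i

namespace Prog

/-! ## Substitution calculus -/

theorem lift_under {n m k : ℕ} (r : Fin n → Fin m) (s : Fin m → Prog k) :
    (fun i => lift s (ext (Fin.succ ∘ r) 0 i)) = lift fun i => s (r i) :=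
  funext fun i => Fin.cases rfl (fun _ => rfl) i

/-- The composition laws build on each other at binders: moving a substitution under a binder
renames it, so composing two substitutions requires both mixed laws, and the law for a renaming
after a substitution requires the one for two renamings. -/
theorem subst_rename {n m k : ℕ} (M : Prog n) (r : Fin n → Fin m) (s : Fin m → Prog k) :
    subst s (rename r M) = subst (fun i => s (r i)) M := by
  induction M generalizing m k <;> simp_all only [rename, subst, lift_under]

theorem rename_rename {n m k : ℕ} (M : Prog n) (r : Fin n → Fin m) (s : Fin m → Fin k) :
    rename s (rename r M) = rename (fun i => s (r i)) M := by
  have h : ∀ {n m k : ℕ} (r : Fin n → Fin m) (s : Fin m → Fin k),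
      (fun i => ext (Fin.succ ∘ s) 0 (ext (Fin.succ ∘ r) 0 i)) =
        ext (Fin.succ ∘ fun i => s (r i)) 0 :=
    fun r s => funext fun i => Fin.cases rfl (fun _ => rfl) i
  induction M generalizing m k <;> simp_all only [rename]

theorem rename_lift {n m k : ℕ} (s : Fin n → Prog m) (r : Fin m → Fin k) :
    (fun i => rename (ext (Fin.succ ∘ r) 0) (lift s i)) = lift fun i => rename r (s i) := by
  refine funext fun i => Fin.cases rfl (fun i => ?_) i
  change rename _ (rename Fin.succ (s i)) = rename Fin.succ (rename r (s i))
  rw [rename_rename, rename_rename]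
  rfl

theorem rename_subst {n m k : ℕ} (M : Prog n) (s : Fin n → Prog m) (r : Fin m → Fin k) :
    rename r (subst s M) = subst (fun i => rename r (s i)) M := by
  induction M generalizing m k <;> simp_all only [rename, subst, rename_lift]

theorem subst_lift {n m k : ℕ} (s : Fin n → Prog m) (t : Fin m → Prog k) :
    (fun i => subst (lift t) (lift s i)) = lift fun i => subst t (s i) := by
  refine funext fun i => Fin.cases rfl (fun i => ?_) i
  change subst (lift t) (rename Fin.succ (s i)) = rename Fin.succ (subst t (s i))
  rw [subst_rename, rename_subst]
  rfl

theorem subst_subst {n m k : ℕ} (M : Prog n) (s : Fin n → Prog m) (t : Fin m → Prog k) :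
    subst t (subst s M) = subst (fun i => subst t (s i)) M := by
  induction M generalizing m k <;> simp_all only [subst, subst_lift]

theorem lift_var {n : ℕ} : lift (.var : Fin n → Prog n) = .var :=
  funext fun i => Fin.cases rfl (fun _ => rfl) i

theorem subst_var {n : ℕ} (M : Prog n) : subst .var M = M := by
  induction M <;> simp_all only [subst, lift_var]

/-- Filling the variable that `lift` has added undoes the weakening of `s`. In the fundamental
theorem this identifies the contractum of a redex whose body stands under a lifted substitution. -/
theorem inst_subst_lift {n m : ℕ} (M : Prog (n + 1)) (s : Fin n → Prog m) (N : Prog m) :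
    (subst (lift s) M).inst N = subst (ext s N) M := by
  rw [inst, subst_subst]
  congr 1
  refine funext fun i => Fin.cases rfl (fun i => ?_) i
  change subst _ (rename Fin.succ (s i)) = s i
  rw [subst_rename]
  exact subst_var _

theorem inst₂_subst_lift {n m : ℕ} (K : Prog (n + 2)) (s : Fin n → Prog m) (M N : Prog m) :
    (subst (lift (lift s)) K).inst₂ M N = subst (ext (ext s M) N) K := by
  rw [inst₂, subst_subst]
  congr 1
  refine funext fun i => Fin.cases rfl (fun i => Fin.cases rfl (fun i => ?_) i) i
  change subst _ (rename Fin.succ (rename Fin.succ (s i))) = s i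
  rw [subst_rename, subst_rename]
  exact subst_var _

end Prog

open Prog

/-! ## Denotations and substitution -/

theorem den_rename {n m : ℕ} (M : Prog n) (r : Fin n → Fin m) (η : Fin m → D) :
    (den (rename r M)).1 η = (den M).1 fun i => η (r i) := by
  induction M generalizing m <;> simp_all only [rename, den, ext_under]

theorem den_lift {n m : ℕ} (s : Fin n → Prog m) (η : Fin m → D) (d : D) :
    (fun i => (den (lift s i)).1 (ext η d)) = ext (fun i => (den (s i)).1 η) d := by
  refine funext fun i => Fin.cases ?_ (fun i => ?_) i
  · change (den (.var 0)).1 (ext η d) = d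
    simp only [den, ext_zero]
  · exact den_rename _ _ _

theorem den_subst {n m : ℕ} (M : Prog n) (s : Fin n → Prog m) (η : Fin m → D) :
    (den (subst s M)).1 η = (den M).1 fun i => (den (s i)).1 η := by
  induction M generalizing m <;> simp_all only [subst, den, den_lift]

theorem den_inst {n : ℕ} (M : Prog (n + 1)) (N : Prog n) (η : Fin n → D) :
    (den (M.inst N)).1 η = (den M).1 (ext η ((den N).1 η)) := by
  rw [inst, den_subst]
  refine congrArg (den M).1 (funext fun i => Fin.cases rfl (fun i => ?_) i)
  simp only [ext_succ, den]

theorem den_inst₂ {n : ℕ} (K : Prog (n + 2)) (M N : Prog n) (η : Fin n → D) :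
    (den (K.inst₂ M N)).1 η = (den K).1 (ext (ext η ((den M).1 η)) ((den N).1 η)) := by
  rw [inst₂, den_subst]
  refine congrArg (den K).1 (funext fun i => Fin.cases rfl (fun i => Fin.cases rfl (fun i => ?_) i) i)
  simp only [ext_succ, den]

/-! ## The constructors of `D` -/

namespace D

@[simp] theorem unroll_bot : unroll ⊥ = .bot := rfl
@[simp] theorem unroll_nil : unroll nil = .nil := unroll_roll _
@[simp] theorem unroll_left (a : D) : unroll (left a) = .left a := unroll_roll _
@[simp] theorem unroll_right (a : D) : unroll (right a) = .right a := unroll_roll _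
@[simp] theorem unroll_pair (a b : D) : unroll (pair a b) = .pair a b := unroll_roll _
@[simp] theorem unroll_amb (a b : D) : unroll (amb a b) = .amb a b := unroll_roll _
@[simp] theorem unroll_fn (f : SMap D D) : unroll (fn f) = .fn f := unroll_roll _

theorem roll_bot : roll .bot = ⊥ := roll_unroll ⊥

/-- Moves an equation in `D` to `Shape`, an inductive type whose constructors `simp` can tell apart.
Clashes of constructors in `D` are refuted this way throughout. -/
theorem unroll_inj {a b : D} : a.unroll = b.unroll ↔ a = b :=
  ⟨fun h => by rw [← roll_unroll a, h, roll_unroll], fun h => h ▸ rfl⟩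

theorem cases_con (a : D) : a = ⊥ ∨ a = nil ∨ (∃ b, a = left b) ∨ (∃ b, a = right b) ∨
    (∃ b c, a = pair b c) ∨ (∃ b c, a = amb b c) ∨ ∃ f, a = fn f := by
  rw [← roll_unroll a, ← roll_bot]
  cases a.unroll with
  | bot => exact Or.inl rfl
  | nil => exact Or.inr (Or.inl rfl)
  | left b => exact Or.inr (Or.inr (Or.inl ⟨b, rfl⟩))
  | right b => exact Or.inr (Or.inr (Or.inr (Or.inl ⟨b, rfl⟩)))
  | pair b c => exact Or.inr (Or.inr (Or.inr (Or.inr (Or.inl ⟨b, c, rfl⟩))))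
  | amb b c => exact Or.inr (Or.inr (Or.inr (Or.inr (Or.inr (Or.inl ⟨b, c, rfl⟩)))))
  | fn f => exact Or.inr (Or.inr (Or.inr (Or.inr (Or.inr (Or.inr ⟨f, rfl⟩)))))

end D

/-! ## Soundness of reduction and progress -/

theorem den_ne_bot_of_whnf {n : ℕ} {M : Prog n} (h : Whnf M) (η : Fin n → D) :
    (den M).1 η ≠ ⊥ := by
  rw [Ne, ← D.unroll_inj]
  cases h with
  | con h => cases h <;> simp [den]
  | lam M => simp [den]

theorem den_of_botLike {n : ℕ} {M : Prog n} (h : BotLike M) (η : Fin n → D) :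
    (den M).1 η = ⊥ := by
  cases h with
  | bot => simp only [den]
  | app h N => cases h <;> simp [den, appVal]
  | sapp h N => cases h <;> simp [den, sappVal]
  | caseSum h hl hr L R =>
    cases h with
    | con h => cases h <;> simp_all [den, caseSumVal]
    | lam M => simp [den, caseSumVal]
  | casePair h hp N =>
    cases h with
    | con h => cases h <;> simp_all [den, casePairVal]
    | lam M => simp [den, casePairVal]
  | caseAmb h ha N =>
    cases h with
    | con h => cases h <;> simp_all [den, caseAmbVal]
    | lam M => simp [den, caseAmbVal]

theorem den_eq_of_red {n : ℕ} {M M' : Prog n} (h : Red M M') (η : Fin n → D) :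
    (den M).1 η = (den M').1 η := by
  induction h with
  | beta M N => simp [den, appVal, den_inst]
  | app _ N ih => simp only [den, ih]
  -- The argument is a w.h.n.f., so its value is not `⊥` and strict application agrees with ordinary
  -- application.
  | sbeta M hN => simp [den, sappVal, den_inst, den_ne_bot_of_whnf hN]
  | sappFun _ _ ih => simp only [den, ih]
  | sappArg M _ ih => simp only [den, ih]
  | recur M =>
    simp only [den, recVal, appVal]
    cases ((den M).1 η).unroll <;> simp
    -- Only the case of a function remains, and there the claim is the fixed point equation; in all
    -- others both sides are `⊥`.
    exact (D.isLeast_lfp _).1.symm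
  | caseLeft M L R => simp [den, caseSumVal, den_inst]
  | caseRight M L R => simp [den, caseSumVal, den_inst]
  | casePair M₁ M₂ N => simp [den, casePairVal, den_inst₂]
  | caseAmb M₁ M₂ N => simp [den, caseAmbVal, den_inst₂]
  | caseSumArg _ L R ih => simp only [den, ih]
  | casePairArg _ N ih => simp only [den, ih]
  | caseAmbArg _ N ih => simp only [den, ih]
  | botLike h => rw [den_of_botLike h]; simp only [den]

theorem val_eq_of_red {M M' : Prog 0} (h : Red M M') : val M = val M' := den_eq_of_red h _

namespace Prog

theorem not_red_of_whnf {n : ℕ} {M M' : Prog n} (h : Whnf M) : ¬ Red M M' := by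
  intro hr
  cases h with
  | con h => cases h <;> cases hr <;> rename_i h <;> cases h
  | lam M => cases hr; rename_i h; cases h

/-- Closedness matters because a variable is stuck. It enters as the equation `n = 0`, so that
structural induction applies to the indexed family `Prog`. -/
theorem whnf_or_red {n : ℕ} (M : Prog n) (hn : n = 0) : Whnf M ∨ ∃ M', Red M M' := by
  induction M with
  | var i => subst hn; exact i.elim0
  | lam M => exact Or.inl (.lam M)
  | bot => exact Or.inr ⟨_, .botLike .bot⟩
  | nil => exact Or.inl (.con .nil)
  | left M => exact Or.inl (.con (.left M))
  | right M => exact Or.inl (.con (.right M))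
  | pair M N => exact Or.inl (.con (.pair M N))
  | amb M N => exact Or.inl (.con (.amb M N))
  | recur M => exact Or.inr ⟨_, .recur M⟩
  | app M N ihM _ =>
    right
    rcases ihM hn with h | ⟨M', h⟩
    · cases h with
      | con h => exact ⟨_, .botLike (.app h N)⟩
      | lam M => exact ⟨_, .beta M N⟩
    · exact ⟨_, .app h N⟩
  | sapp M N ihM ihN =>
    right
    -- The argument is examined before the function, since a strict application may reduce its
    -- function only when the argument is a w.h.n.f.
    rcases ihN hn with hN | ⟨N', h⟩
    · rcases ihM hn with h | ⟨M', h⟩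
      · cases h with
        | con h => exact ⟨_, .botLike (.sapp h N)⟩
        | lam M => exact ⟨_, .sbeta M hN⟩
      · exact ⟨_, .sappFun hN h⟩
    · exact ⟨_, .sappArg M h⟩
  | caseSum M L R ihM _ _ =>
    right
    rcases ihM hn with h | ⟨M', h⟩
    · by_cases hl : ∃ K, M = .left K
      · obtain ⟨K, rfl⟩ := hl
        exact ⟨_, .caseLeft K L R⟩
      · by_cases hr : ∃ K, M = .right K
        · obtain ⟨K, rfl⟩ := hr
          exact ⟨_, .caseRight K L R⟩
        · exact ⟨_, .botLike (.caseSum h (fun K e => hl ⟨K, e⟩) (fun K e => hr ⟨K, e⟩) L R)⟩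
    · exact ⟨_, .caseSumArg h L R⟩
  | casePair M N ihM _ =>
    right
    rcases ihM hn with h | ⟨M', h⟩
    · by_cases hp : ∃ K L, M = .pair K L
      · obtain ⟨K, L, rfl⟩ := hp
        exact ⟨_, .casePair K L N⟩
      · exact ⟨_, .botLike (.casePair h (fun K L e => hp ⟨K, L, e⟩) N)⟩
    · exact ⟨_, .casePairArg h N⟩
  | caseAmb M N ihM _ =>
    right
    rcases ihM hn with h | ⟨M', h⟩
    · by_cases hp : ∃ K L, M = .amb K L
      · obtain ⟨K, L, rfl⟩ := hp
        exact ⟨_, .caseAmb K L N⟩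
      · exact ⟨_, .botLike (.caseAmb h (fun K L e => hp ⟨K, L, e⟩) N)⟩
    · exact ⟨_, .caseAmbArg h N⟩

theorem exists_red_of_not_whnf {M : Prog 0} (h : ¬ Whnf M) : ∃ M', Red M M' :=
  (whnf_or_red M rfl).resolve_left h

end Prog

/-! ## Adequacy: programs with a denotation other than `⊥` have a weak head normal form -/

/-- Many-step reduction of closed programs. -/
abbrev Steps : Prog 0 → Prog 0 → Prop := Relation.ReflTransGen Red

/-- The logical relation between the `n`-th approximation of `D` and closed programs. -/
def Rel : (n : ℕ) → Lv n → Prog 0 → Prop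
  | 0, _, _ => True
  | n + 1, x, M => match (x : LvS n) with
    | .bot => True
    | .nil => Steps M .nil
    | .left a => ∃ N, Steps M (.left N) ∧ Rel n a N
    | .right a => ∃ N, Steps M (.right N) ∧ Rel n a N
    | .pair a b => ∃ N K, Steps M (.pair N K) ∧ Rel n a N ∧ Rel n b K
    | .amb a b => ∃ N K, Steps M (.amb N K) ∧ Rel n a N ∧ Rel n b K
    | .fn g => ∃ N, Steps M (.lam N) ∧ ∀ y K, Rel n y K → Rel n (g y) (N.inst K)

theorem rel_bot (n : ℕ) (M : Prog 0) : Rel n ⊥ M := by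
  cases n <;> exact trivial

theorem Rel.of_steps {n : ℕ} {x : Lv n} {M M' : Prog 0} (h : Steps M M') (hr : Rel n x M') :
    Rel n x M := by
  cases n with
  | zero => exact trivial
  | succ n =>
    change LvS n at x
    cases x with
    | bot => exact trivial
    | nil => exact h.trans hr
    | left a => exact hr.imp fun N hN => ⟨h.trans hN.1, hN.2⟩
    | right a => exact hr.imp fun N hN => ⟨h.trans hN.1, hN.2⟩
    | pair a b => exact hr.imp fun N hN => hN.imp fun K hK => ⟨h.trans hK.1, hK.2⟩
    | amb a b => exact hr.imp fun N hN => hN.imp fun K hK => ⟨h.trans hK.1, hK.2⟩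
    | fn g => exact hr.imp fun N hN => ⟨h.trans hN.1, hN.2⟩

/-- The clause for functions is contravariant: an argument of level `m` must first be carried back
to level `n`. Preservation is therefore assumed, and then proved by induction, in both directions at
once. -/
theorem rel_tr_succ {n m : ℕ} (hf : ∀ x M, Rel n x M → Rel m (tr n m x) M)
    (hb : ∀ x M, Rel m x M → Rel n (tr m n x) M) (x : Lv (n + 1)) (M : Prog 0)
    (h : Rel (n + 1) x M) : Rel (m + 1) (tr (n + 1) (m + 1) x) M := by
  rw [tr_succ]
  change LvS n at x
  cases x with
  | bot => exact trivial
  | nil => exact h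
  | left a => exact h.imp fun N hN => ⟨hN.1, hf _ _ hN.2⟩
  | right a => exact h.imp fun N hN => ⟨hN.1, hf _ _ hN.2⟩
  | pair a b => exact h.imp fun N hN => hN.imp fun K hK => ⟨hK.1, hf _ _ hK.2.1, hf _ _ hK.2.2⟩
  | amb a b => exact h.imp fun N hN => hN.imp fun K hK => ⟨hK.1, hf _ _ hK.2.1, hf _ _ hK.2.2⟩
  | fn g => exact h.imp fun N hN => ⟨hN.1, fun y K hy => hf _ _ (hN.2 _ _ (hb _ _ hy))⟩

theorem rel_tr_both (n m : ℕ) : (∀ x M, Rel n x M → Rel m (tr n m x) M) ∧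
    ∀ x M, Rel m x M → Rel n (tr m n x) M := by
  induction n generalizing m with
  | zero => exact ⟨fun x M _ => by rw [tr_zero_left]; exact rel_bot m M, fun _ _ _ => trivial⟩
  | succ n ih =>
    cases m with
    | zero => exact ⟨fun _ _ _ => trivial, fun x M _ => by rw [tr_zero_left]; exact rel_bot _ M⟩
    | succ m => exact ⟨rel_tr_succ (ih m).1 (ih m).2, rel_tr_succ (ih m).2 (ih m).1⟩

theorem Rel.tr {n : ℕ} {x : Lv n} {M : Prog 0} (h : Rel n x M) (m : ℕ) :
    Rel m (AmbLang.tr n m x) M :=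
  (rel_tr_both n m).1 x M h

theorem Rel.exists_whnf {n : ℕ} {x : Lv (n + 1)} {M : Prog 0} (h : Rel (n + 1) x M) (hx : x ≠ ⊥) :
    ∃ W, Whnf W ∧ Steps M W ∧ Rel (n + 1) x W := by
  change LvS n at x
  cases x with
  | bot => exact absurd rfl hx
  | nil => exact ⟨_, .con .nil, h, .refl⟩
  | left a =>
    obtain ⟨N, hN, hr⟩ := h
    exact ⟨_, .con (.left N), hN, N, .refl, hr⟩
  | right a =>
    obtain ⟨N, hN, hr⟩ := h
    exact ⟨_, .con (.right N), hN, N, .refl, hr⟩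
  | pair a b =>
    obtain ⟨N, K, hN, hr⟩ := h
    exact ⟨_, .con (.pair N K), hN, N, K, .refl, hr⟩
  | amb a b =>
    obtain ⟨N, K, hN, hr⟩ := h
    exact ⟨_, .con (.amb N K), hN, N, K, .refl, hr⟩
  | fn g =>
    obtain ⟨N, hN, hr⟩ := h
    exact ⟨_, .lam N, hN, N, .refl, hr⟩

/-! ### The logical relation on all of `D` and its fundamental theorem -/

/-- The logical relation between `D` and closed programs. -/
def RelD (d : D) (M : Prog 0) : Prop := ∀ n, Rel n (d.cut n) M

theorem relD_bot (M : Prog 0) : RelD ⊥ M := fun n => rel_bot n M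

theorem RelD.of_steps {d : D} {M M' : Prog 0} (h : Steps M M') (hr : RelD d M') : RelD d M :=
  fun n => (hr n).of_steps h

theorem relD_emb {n : ℕ} {x : Lv n} {M : Prog 0} (h : Rel n x M) : RelD (D.emb n x) M :=
  fun m => h.tr m

/-- A continuous function of an environment attains every level of its values at approximations
of the environment. -/
theorem exists_approx {n : ℕ} (F : SMap (Fin n → D) D) (η : Fin n → D) (k : ℕ) :
    ∃ j, k ≤ j ∧ (F.1 fun i => D.emb j ((η i).cut j)).cut k = (F.1 η).cut k := by
  have hm : Monotone fun j : ℕ => fun i => D.emb j ((η i).cut j) :=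
    fun a b h i => D.emb_cut_mono (η i) h
  have hl : IsLUB (Set.range fun j : ℕ => fun i => D.emb j ((η i).cut j)) η := by
    refine isLUB_pi.2 fun i => ?_
    rw [← Set.range_comp]
    exact D.isLUB_emb (η i)
  obtain ⟨_, ⟨j, rfl⟩, e⟩ := (scott_iff.1 F.2).2 _ (Set.range_nonempty _)
    (directedOn_range.2 (Monotone.directed_le hm)) η hl k
  refine ⟨max k j, le_max_left _ _, le_antisymm ?_ ?_⟩
  · exact F.2.monotone (hl.1 ⟨_, rfl⟩) k
  · exact e.symm.le.trans (F.2.monotone (hm (le_max_right k j)) k)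

/-- `RelD` at a constructor provides witnesses level by level, and these may differ between levels,
so no single argument program is known to be related to a whole component. Continuity reduces the
claim to approximated environments, for which the witnesses of one level suffice. -/
theorem relD_of_approx {n : ℕ} (F : SMap (Fin n → D) D) (η : Fin n → D) {M : Prog 0}
    (h : ∀ j, RelD (F.1 fun i => D.emb j ((η i).cut j)) M) : RelD (F.1 η) M := by
  intro k
  obtain ⟨j, -, e⟩ := exists_approx F η k
  rw [← e]
  exact h j k

theorem exists_approx_fun (f : SMap D D) (d : D) (k : ℕ) :
    ∃ j, k ≤ j ∧ (f.1 (D.emb j (d.cut j))).cut k = (f.1 d).cut k :=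
  exists_approx ⟨fun η : Fin 1 → D => f.1 (η 0), scott_comp f.2 (scott_proj 0)⟩ (fun _ => d) k

theorem RelD.app {x y : D} {M N : Prog 0} (hx : RelD x M) (hy : RelD y N) :
    RelD (appVal x y) (.app M N) := by
  rcases x.cases_con with rfl | rfl | ⟨a, rfl⟩ | ⟨a, rfl⟩ | ⟨a, b, rfl⟩ | ⟨a, b, rfl⟩ | ⟨f, rfl⟩ <;>
    simp only [appVal, D.unroll_bot, D.unroll_nil, D.unroll_left, D.unroll_right, D.unroll_pair,
      D.unroll_amb, D.unroll_fn, relD_bot]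
  intro k
  obtain ⟨j, hj, e⟩ := exists_approx_fun f y k
  -- The function component of level `j + 1` acts on level `j`, the level at which the argument is
  -- approximated.
  obtain ⟨L, hL, h⟩ := hx (j + 1)
  rw [← e, ← D.coh _ k j hj]
  refine Rel.tr ?_ k
  refine Rel.of_steps ?_ (h _ _ (hy j))
  exact (hL.lift (fun M => Prog.app M N) fun _ _ h => .app h N).tail (.beta L N)

theorem RelD.sapp {x y : D} {M N : Prog 0} (hx : RelD x M) (hy : RelD y N) :
    RelD (sappVal x y) (.sapp M N) := by
  rcases x.cases_con with rfl | rfl | ⟨a, rfl⟩ | ⟨a, rfl⟩ | ⟨a, b, rfl⟩ | ⟨a, b, rfl⟩ | ⟨f, rfl⟩ <;>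
    simp only [sappVal, D.unroll_bot, D.unroll_nil, D.unroll_left, D.unroll_right, D.unroll_pair,
      D.unroll_amb, D.unroll_fn, relD_bot]
  split_ifs with hb
  · exact relD_bot _
  intro k
  obtain ⟨j, hj, e⟩ := exists_approx_fun f y k
  obtain ⟨L, hL, h⟩ := hx (j + 1)
  -- A value other than `⊥` already shows at level `1`. This yields the w.h.n.f. of the argument
  -- that must be reached before the function is reduced.
  have hyj : y.cut (j + 1) ≠ ⊥ := by
    intro h0
    refine hb (cut_one_eq_bot.1 ?_)
    rw [← y.coh 1 (j + 1) (by omega), h0, tr_bot]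
    rfl
  obtain ⟨W, hW, hNW, hr⟩ := (hy (j + 1)).exists_whnf hyj
  rw [← e, ← D.coh _ k j hj]
  refine Rel.tr ?_ k
  have hr' : Rel j (y.cut j) W := by
    rw [← y.coh j (j + 1) (by omega)]
    exact hr.tr j
  refine Rel.of_steps ?_ (h _ _ hr')
  have h1 : Steps (.sapp M N) (.sapp M W) :=
    hNW.lift (fun N => Prog.sapp M N) fun _ _ h => .sappArg M h
  have h2 : Steps (.sapp M W) (.sapp (.lam L) W) :=
    hL.lift (fun M => Prog.sapp M W) fun _ _ h => .sappFun hW h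
  exact (h1.trans h2).tail (.sbeta L hW)

/-- Every iterate from `⊥` is related to `rec M`, because one step unfolds `rec M` to `M (rec M)`;
and every level of the least fixed point is attained by an iterate. -/
theorem RelD.recur {x : D} {M : Prog 0} (hx : RelD x M) : RelD (recVal x) (.recur M) := by
  rcases x.cases_con with rfl | rfl | ⟨a, rfl⟩ | ⟨a, rfl⟩ | ⟨a, b, rfl⟩ | ⟨a, b, rfl⟩ | ⟨f, rfl⟩ <;>
    simp only [recVal, D.unroll_bot, D.unroll_nil, D.unroll_left, D.unroll_right, D.unroll_pair,
      D.unroll_amb, D.unroll_fn, relD_bot]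
  have h : ∀ k : ℕ, RelD (f.1^[k] ⊥) (.recur M) := by
    intro k
    induction k with
    | zero => exact relD_bot _
    | succ k ih =>
      rw [Function.iterate_succ_apply']
      have := hx.app ih
      simp only [appVal, D.unroll_fn] at this
      exact this.of_steps (.single (.recur M))
  intro n
  obtain ⟨k, hk⟩ := D.attain_range (iterate_mono f.2.monotone) n
  rw [D.lfp, ← hk]
  exact h k n

/-- The branch of a case distinction. -/
theorem relD_branch {n : ℕ} {N : Prog n}
    (ih : ∀ (η : Fin n → D) (s : Fin n → Prog 0), (∀ i, RelD (η i) (s i)) →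
      RelD ((den N).1 η) (subst s N)) (η : Fin n → D) {P : Prog 0}
    (h : ∀ j, ∃ t : Fin n → Prog 0, Steps P (subst t N) ∧ ∀ i, Rel j ((η i).cut j) (t i)) :
    RelD ((den N).1 η) P := by
  refine relD_of_approx (den N) η fun j => ?_
  obtain ⟨t, ht, hr⟩ := h j
  exact (ih _ t fun i => relD_emb (hr i)).of_steps ht

theorem forall_ext {X Y : Type} {n : ℕ} {p : X → Y → Prop} {η : Fin n → X} {s : Fin n → Y} {a : X}
    {b : Y} (h : ∀ i, p (η i) (s i)) (h0 : p a b) : ∀ i, p (ext η a i) (ext s b i) :=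
  fun i => Fin.cases h0 h i

/-- The fundamental theorem of the logical relation. -/
theorem relD_den {n : ℕ} (M : Prog n) (η : Fin n → D) (s : Fin n → Prog 0)
    (h : ∀ i, RelD (η i) (s i)) : RelD ((den M).1 η) (subst s M) := by
  induction M with
  | var i => simpa only [den, subst] using h i
  | lam M ih =>
    simp only [den, subst]
    intro k
    cases k with
    | zero => exact trivial
    | succ k =>
      refine ⟨_, .refl, fun y K hy => ?_⟩
      rw [inst_subst_lift]
      -- The argument is given at level `k` only; its embedding into `D` is related to `K` at all
      -- levels, as the induction hypothesis demands.
      exact ih _ _ (forall_ext h (relD_emb hy)) k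
  | app M N ihM ihN => simpa only [den, subst] using (ihM η s h).app (ihN η s h)
  | sapp M N ihM ihN => simpa only [den, subst] using (ihM η s h).sapp (ihN η s h)
  | recur M ih => simpa only [den, subst] using (ih η s h).recur
  | bot => simpa only [den, subst] using relD_bot _
  | nil =>
    simp only [den, subst]
    rintro (_ | k)
    · exact trivial
    · exact Relation.ReflTransGen.refl
  | left M ih =>
    simp only [den, subst]
    rintro (_ | k)
    · exact trivial
    · exact ⟨_, .refl, ih η s h k⟩
  | right M ih =>
    simp only [den, subst]
    rintro (_ | k)
    · exact trivial
    · exact ⟨_, .refl, ih η s h k⟩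
  | pair M N ihM ihN =>
    simp only [den, subst]
    rintro (_ | k)
    · exact trivial
    · exact ⟨_, _, .refl, ihM η s h k, ihN η s h k⟩
  | amb M N ihM ihN =>
    simp only [den, subst]
    rintro (_ | k)
    · exact trivial
    · exact ⟨_, _, .refl, ihM η s h k, ihN η s h k⟩
  | caseSum M L R ihM ihL ihR =>
    have hM := ihM η s h
    simp only [den, subst]
    rcases ((den M).1 η).cases_con with e | e | ⟨a, e⟩ | ⟨a, e⟩ | ⟨a, b, e⟩ | ⟨a, b, e⟩ | ⟨f, e⟩ <;>
      simp only [e, caseSumVal, D.unroll_bot, D.unroll_nil, D.unroll_left, D.unroll_right,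
        D.unroll_pair, D.unroll_amb, D.unroll_fn, relD_bot] <;> rw [e] at hM
    · refine relD_branch ihL _ fun j => ?_
      obtain ⟨K, hK, hr⟩ := hM (j + 1)
      refine ⟨ext s K, ?_, forall_ext (p := fun (x : D) => Rel j (x.cut j)) (fun i => h i j) hr⟩
      rw [← inst_subst_lift]
      exact (hK.lift (fun M => Prog.caseSum M _ _) fun _ _ h => .caseSumArg h _ _).tail
        (.caseLeft _ _ _)
    · refine relD_branch ihR _ fun j => ?_
      obtain ⟨K, hK, hr⟩ := hM (j + 1)
      refine ⟨ext s K, ?_, forall_ext (p := fun (x : D) => Rel j (x.cut j)) (fun i => h i j) hr⟩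
      rw [← inst_subst_lift]
      exact (hK.lift (fun M => Prog.caseSum M _ _) fun _ _ h => .caseSumArg h _ _).tail
        (.caseRight _ _ _)
  | casePair M N ihM ihN =>
    have hM := ihM η s h
    simp only [den, subst]
    rcases ((den M).1 η).cases_con with e | e | ⟨a, e⟩ | ⟨a, e⟩ | ⟨a, b, e⟩ | ⟨a, b, e⟩ | ⟨f, e⟩ <;>
      simp only [e, casePairVal, D.unroll_bot, D.unroll_nil, D.unroll_left, D.unroll_right,
        D.unroll_pair, D.unroll_amb, D.unroll_fn, relD_bot]
    rw [e] at hM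
    refine relD_branch ihN _ fun j => ?_
    obtain ⟨K, L, hK, hr, hr'⟩ := hM (j + 1)
    refine ⟨ext (ext s K) L, ?_, forall_ext (p := fun (x : D) => Rel j (x.cut j))
      (forall_ext (p := fun (x : D) => Rel j (x.cut j)) (fun i => h i j) hr) hr'⟩
    rw [← inst₂_subst_lift]
    exact (hK.lift (fun M => Prog.casePair M _) fun _ _ h => .casePairArg h _).tail
      (.casePair _ _ _)
  | caseAmb M N ihM ihN =>
    have hM := ihM η s h
    simp only [den, subst]
    rcases ((den M).1 η).cases_con with e | e | ⟨a, e⟩ | ⟨a, e⟩ | ⟨a, b, e⟩ | ⟨a, b, e⟩ | ⟨f, e⟩ <;>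
      simp only [e, caseAmbVal, D.unroll_bot, D.unroll_nil, D.unroll_left, D.unroll_right,
        D.unroll_pair, D.unroll_amb, D.unroll_fn, relD_bot]
    rw [e] at hM
    refine relD_branch ihN _ fun j => ?_
    obtain ⟨K, L, hK, hr, hr'⟩ := hM (j + 1)
    refine ⟨ext (ext s K) L, ?_, forall_ext (p := fun (x : D) => Rel j (x.cut j))
      (forall_ext (p := fun (x : D) => Rel j (x.cut j)) (fun i => h i j) hr) hr'⟩
    rw [← inst₂_subst_lift]
    exact (hK.lift (fun M => Prog.caseAmb M _) fun _ _ h => .caseAmbArg h _).tail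
      (.caseAmb _ _ _)

/-- Adequacy: a closed program whose denotation is not `⊥` has a weak head normal form. -/
theorem exists_steps_whnf {M : Prog 0} (h : val M ≠ ⊥) : ∃ W, Whnf W ∧ Steps M W := by
  -- Level `1` is enough, since it records the outermost constructor.
  have hr := relD_den M Fin.elim0 Fin.elim0 (fun i => i.elim0) 1
  have e : subst Fin.elim0 M = M := by
    rw [Subsingleton.elim (Fin.elim0 : Fin 0 → Prog 0) .var, subst_var]
  rw [e] at hr
  obtain ⟨W, hW, hs, -⟩ := Rel.exists_whnf (n := 0) hr fun h0 => h (cut_one_eq_bot.1 h0)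
  exact ⟨W, hW, hs⟩

/-! ## Elements of regular types have no nested `Amb` -/

namespace D

theorem left_inj {a b : D} : left a = left b ↔ a = b := by simp [← unroll_inj]
theorem right_inj {a b : D} : right a = right b ↔ a = b := by simp [← unroll_inj]
theorem pair_inj {a b a' b' : D} : pair a b = pair a' b' ↔ a = a' ∧ b = b' := by
  rw [← unroll_inj]; simp
theorem unroll_le {a b : D} (h : a ≤ b) : a.unroll ≤ b.unroll :=
  le_of_roll_le (by rwa [roll_unroll, roll_unroll])

theorem unroll_le_iff {a b : D} : a.unroll ≤ b.unroll ↔ a ≤ b :=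
  ⟨fun h => by simpa only [roll_unroll] using roll_mono h, unroll_le⟩

theorem left_le_left {a b : D} : left a ≤ left b ↔ a ≤ b := by
  rw [← unroll_le_iff, unroll_left, unroll_left]
  exact ⟨fun h => by cases h; assumption, .left⟩

theorem right_le_right {a b : D} : right a ≤ right b ↔ a ≤ b := by
  rw [← unroll_le_iff, unroll_right, unroll_right]
  exact ⟨fun h => by cases h; assumption, .right⟩

theorem pair_le_pair {a b a' b' : D} : pair a b ≤ pair a' b' ↔ a ≤ a' ∧ b ≤ b' := by
  rw [← unroll_le_iff, unroll_pair, unroll_pair]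
  exact ⟨fun h => by cases h; exact ⟨by assumption, by assumption⟩, fun h => .pair h.1 h.2⟩

theorem amb_le_amb {a b a' b' : D} : amb a b ≤ amb a' b' ↔ a ≤ a' ∧ b ≤ b' := by
  rw [← unroll_le_iff, unroll_amb, unroll_amb]
  exact ⟨fun h => by cases h; exact ⟨by assumption, by assumption⟩, fun h => .amb h.1 h.2⟩

theorem le_left {a b : D} (h : a ≤ left b) : a = ⊥ ∨ ∃ c, a = left c := by
  have := unroll_le h
  rcases a.cases_con with rfl | rfl | ⟨c, rfl⟩ | ⟨c, rfl⟩ | ⟨c, d, rfl⟩ | ⟨c, d, rfl⟩ | ⟨f, rfl⟩ <;>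
    simp at this ⊢ <;> cases this

theorem le_right {a b : D} (h : a ≤ right b) : a = ⊥ ∨ ∃ c, a = right c := by
  have := unroll_le h
  rcases a.cases_con with rfl | rfl | ⟨c, rfl⟩ | ⟨c, rfl⟩ | ⟨c, d, rfl⟩ | ⟨c, d, rfl⟩ | ⟨f, rfl⟩ <;>
    simp at this ⊢ <;> cases this

theorem le_pair {a b b' : D} (h : a ≤ pair b b') : a = ⊥ ∨ ∃ c c', a = pair c c' := by
  have := unroll_le h
  rcases a.cases_con with rfl | rfl | ⟨c, rfl⟩ | ⟨c, rfl⟩ | ⟨c, d, rfl⟩ | ⟨c, d, rfl⟩ | ⟨f, rfl⟩ <;>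
    simp at this ⊢ <;> cases this

theorem le_amb {a b b' : D} (h : a ≤ amb b b') : a = ⊥ ∨ ∃ c c', a = amb c c' := by
  have := unroll_le h
  rcases a.cases_con with rfl | rfl | ⟨c, rfl⟩ | ⟨c, rfl⟩ | ⟨c, d, rfl⟩ | ⟨c, d, rfl⟩ | ⟨f, rfl⟩ <;>
    simp at this ⊢ <;> cases this

/-- Whatever lies below `left b` is `⊥` or begins with `left`, and `⊥` contributes nothing to a
supremum. -/
theorem isLUB_left {S : Set D} {b : D} (h : IsLUB S (left b)) : IsLUB {c | left c ∈ S} b := by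
  refine ⟨fun c hc => left_le_left.1 (h.1 hc), fun e he => left_le_left.1 (h.2 fun s hs => ?_)⟩
  rcases le_left (h.1 hs) with rfl | ⟨c, rfl⟩
  · exact bot_le
  · exact left_le_left.2 (he hs)

theorem isLUB_right {S : Set D} {b : D} (h : IsLUB S (right b)) : IsLUB {c | right c ∈ S} b := by
  refine ⟨fun c hc => right_le_right.1 (h.1 hc), fun e he => right_le_right.1 (h.2 fun s hs => ?_)⟩
  rcases le_right (h.1 hs) with rfl | ⟨c, rfl⟩
  · exact bot_le
  · exact right_le_right.2 (he hs)

/-- To bound one component, the supremum is compared with a pair whose other component is left as it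
is. -/
theorem isLUB_pair {S : Set D} {b b' : D} (h : IsLUB S (pair b b')) :
    IsLUB {c | ∃ c', pair c c' ∈ S} b ∧ IsLUB {c' | ∃ c, pair c c' ∈ S} b' := by
  refine ⟨⟨fun c ⟨c', hc⟩ => (pair_le_pair.1 (h.1 hc)).1, fun e he =>
    (pair_le_pair.1 (h.2 fun s hs => ?_ : pair b b' ≤ pair e b')).1⟩,
    ⟨fun c' ⟨c, hc⟩ => (pair_le_pair.1 (h.1 hc)).2, fun e he =>
    (pair_le_pair.1 (h.2 fun s hs => ?_ : pair b b' ≤ pair b e)).2⟩⟩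
  all_goals
    have hsb := h.1 hs
    rcases le_pair hsb with rfl | ⟨c, c', rfl⟩
    · exact bot_le
  · exact pair_le_pair.2 ⟨he ⟨c', hs⟩, (pair_le_pair.1 hsb).2⟩
  · exact pair_le_pair.2 ⟨(pair_le_pair.1 hsb).1, he ⟨c, hs⟩⟩

theorem isLUB_amb {S : Set D} {b b' : D} (h : IsLUB S (amb b b')) :
    IsLUB {c | ∃ c', amb c c' ∈ S} b ∧ IsLUB {c' | ∃ c, amb c c' ∈ S} b' := by
  refine ⟨⟨fun c ⟨c', hc⟩ => (amb_le_amb.1 (h.1 hc)).1, fun e he =>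
    (amb_le_amb.1 (h.2 fun s hs => ?_ : amb b b' ≤ amb e b')).1⟩,
    ⟨fun c' ⟨c, hc⟩ => (amb_le_amb.1 (h.1 hc)).2, fun e he =>
    (amb_le_amb.1 (h.2 fun s hs => ?_ : amb b b' ≤ amb b e)).2⟩⟩
  all_goals
    have hsb := h.1 hs
    rcases le_amb hsb with rfl | ⟨c, c', rfl⟩
    · exact bot_le
  · exact amb_le_amb.2 ⟨he ⟨c', hs⟩, (amb_le_amb.1 hsb).2⟩
  · exact amb_le_amb.2 ⟨(amb_le_amb.1 hsb).1, he ⟨c, hs⟩⟩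

end D

/-! ### The subdomain of tame elements -/

/-- The elements of `D` that do not begin with `Amb`. -/
def nonAmb : Set D := {a | ∀ b c, a ≠ D.amb b c}

/-- Below an element that begins with `Amb` there are only `⊥` and elements that begin with `Amb`.
If such an element were the supremum of a subset of `nonAmb`, that subset would contain at most `⊥`,
so the supremum would be `⊥`. -/
theorem isSubdomain_nonAmb : IsSubdomain nonAmb := by
  refine ⟨fun a b hba ha c d e => ?_, fun S hS a ha c d e => ?_⟩
  · subst e
    have := D.unroll_le hba
    rcases a.cases_con with rfl | rfl | ⟨c, rfl⟩ | ⟨c, rfl⟩ | ⟨c, d, rfl⟩ | ⟨c, d, rfl⟩ | ⟨f, rfl⟩ <;>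
      simp at this <;> cases this
    exact ha _ _ rfl
  · subst e
    have h : D.amb c d ≤ ⊥ := ha.2 fun s hs => by
      rcases D.le_amb (ha.1 hs) with rfl | ⟨b, b', rfl⟩
      · exact le_rfl
      · exact absurd rfl (hS hs b b')
    have := D.unroll_le h
    simp at this
    cases this

/-- The operator whose largest fixed point is `tame`. -/
def TameStep (R : Set D) (a : D) : Prop :=
  (∀ b c, a = D.amb b c → (b ∈ nonAmb ∧ c ∈ nonAmb) ∧ b ∈ R ∧ c ∈ R) ∧
  (∀ b, a = D.left b → b ∈ R) ∧ (∀ b, a = D.right b → b ∈ R) ∧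
  ∀ b c, a = D.pair b c → b ∈ R ∧ c ∈ R

theorem TameStep.mono {R R' : Set D} (h : R ⊆ R') {a : D} (ha : TameStep R a) : TameStep R' a :=
  ⟨fun b c e => ⟨(ha.1 b c e).1, h (ha.1 b c e).2.1, h (ha.1 b c e).2.2⟩,
    fun b e => h (ha.2.1 b e), fun b e => h (ha.2.2.1 b e),
    fun b c e => ⟨h (ha.2.2.2 b c e).1, h (ha.2.2.2 b c e).2⟩⟩

/-- The elements of `D` in which, hereditarily below constructors, no argument of `Amb` begins
with `Amb`. -/
def tame : Set D := {a | ∃ R : Set D, (∀ x ∈ R, TameStep R x) ∧ a ∈ R}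

theorem tameStep_of_mem_tame {a : D} (h : a ∈ tame) : TameStep tame a := by
  obtain ⟨R, hR, ha⟩ := h
  exact (hR a ha).mono fun x hx => (⟨R, hR, hx⟩ : x ∈ tame)

/-- Adjoining `a` to `tame` keeps it closed under `TameStep`, and `tame` is the largest such set. -/
theorem mem_tame {a : D} (h : TameStep tame a) : a ∈ tame := by
  refine ⟨insert a tame, ?_, Set.mem_insert _ _⟩
  rintro x (rfl | hx)
  · exact h.mono (Set.subset_insert _ _)
  · exact (tameStep_of_mem_tame hx).mono (Set.subset_insert _ _)

/-- Coinduction, twice: the downward closure of `tame` and the set of suprema of subsets of `tame`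
are both closed under `TameStep`. For suprema this holds because a constructor's components are the
suprema of the corresponding components. The result makes `tame` a competitor in the intersection
that defines `fix`. -/
theorem isSubdomain_tame : IsSubdomain tame := by
  constructor
  · intro a b hba ha
    refine ⟨{x | ∃ y ∈ tame, x ≤ y}, ?_, a, ha, hba⟩
    rintro x ⟨y, hy, hxy⟩
    have hs := tameStep_of_mem_tame hy
    have hu := D.unroll_le hxy
    refine ⟨?_, ?_, ?_, ?_⟩
    · rintro b c rfl
      rcases y.cases_con with rfl | rfl | ⟨d, rfl⟩ | ⟨d, rfl⟩ | ⟨d, e, rfl⟩ | ⟨d, e, rfl⟩ | ⟨f, rfl⟩ <;>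
        simp at hu <;> cases hu
      rename_i h k
      obtain ⟨⟨h1, h2⟩, h3, h4⟩ := hs.1 _ _ rfl
      exact ⟨⟨isSubdomain_nonAmb.1 h h1, isSubdomain_nonAmb.1 k h2⟩, ⟨_, h3, h⟩, ⟨_, h4, k⟩⟩
    · rintro b rfl
      rcases y.cases_con with rfl | rfl | ⟨d, rfl⟩ | ⟨d, rfl⟩ | ⟨d, e, rfl⟩ | ⟨d, e, rfl⟩ | ⟨f, rfl⟩ <;>
        simp at hu <;> cases hu
      rename_i h
      exact ⟨_, hs.2.1 _ rfl, h⟩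
    · rintro b rfl
      rcases y.cases_con with rfl | rfl | ⟨d, rfl⟩ | ⟨d, rfl⟩ | ⟨d, e, rfl⟩ | ⟨d, e, rfl⟩ | ⟨f, rfl⟩ <;>
        simp at hu <;> cases hu
      rename_i h
      exact ⟨_, hs.2.2.1 _ rfl, h⟩
    · rintro b c rfl
      rcases y.cases_con with rfl | rfl | ⟨d, rfl⟩ | ⟨d, rfl⟩ | ⟨d, e, rfl⟩ | ⟨d, e, rfl⟩ | ⟨f, rfl⟩ <;>
        simp at hu <;> cases hu
      rename_i h k
      obtain ⟨h1, h2⟩ := hs.2.2.2 _ _ rfl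
      exact ⟨⟨_, h1, h⟩, ⟨_, h2, k⟩⟩
  · intro S hS a ha
    refine ⟨{x | ∃ T ⊆ tame, IsLUB T x}, ?_, S, hS, ha⟩
    rintro x ⟨T, hT, hx⟩
    refine ⟨?_, ?_, ?_, ?_⟩
    · rintro b c rfl
      obtain ⟨h1, h2⟩ := D.isLUB_amb hx
      have hs := fun b c (h : D.amb b c ∈ T) => (tameStep_of_mem_tame (hT h)).1 b c rfl
      refine ⟨⟨isSubdomain_nonAmb.2 _ ?_ _ h1, isSubdomain_nonAmb.2 _ ?_ _ h2⟩,
        ⟨_, ?_, h1⟩, ⟨_, ?_, h2⟩⟩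
      · rintro d ⟨e, h⟩
        exact (hs _ _ h).1.1
      · rintro d ⟨e, h⟩
        exact (hs _ _ h).1.2
      · rintro d ⟨e, h⟩
        exact (hs _ _ h).2.1
      · rintro d ⟨e, h⟩
        exact (hs _ _ h).2.2
    · rintro b rfl
      exact ⟨_, fun d (h : D.left d ∈ T) => (tameStep_of_mem_tame (hT h)).2.1 _ rfl,
        D.isLUB_left hx⟩
    · rintro b rfl
      exact ⟨_, fun d (h : D.right d ∈ T) => (tameStep_of_mem_tame (hT h)).2.2.1 _ rfl,
        D.isLUB_right hx⟩
    · rintro b c rfl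
      obtain ⟨h1, h2⟩ := D.isLUB_pair hx
      have hs := fun b c (h : D.pair b c ∈ T) => (tameStep_of_mem_tame (hT h)).2.2.2 b c rfl
      refine ⟨⟨_, ?_, h1⟩, ⟨_, ?_, h2⟩⟩
      · rintro d ⟨e, h⟩
        exact (hs _ _ h).1
      · rintro d ⟨e, h⟩
        exact (hs _ _ h).2

theorem IsSubdomain.inter {X Y : Set D} (hX : IsSubdomain X) (hY : IsSubdomain Y) :
    IsSubdomain (X ∩ Y) :=
  ⟨hX.1.inter hY.1, fun S hS a ha => ⟨hX.2 S (fun _ h => (hS h).1) a ha,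
    hY.2 S (fun _ h => (hS h).2) a ha⟩⟩

theorem bot_mem_tame : ⊥ ∈ tame := mem_tame (by simp [TameStep, ← D.unroll_inj])

theorem left_mem_tame {a : D} (h : a ∈ tame) : D.left a ∈ tame := by
  refine mem_tame ⟨fun _ _ e => ?_, fun _ e => ?_, fun _ e => ?_, fun _ _ e => ?_⟩ <;>
    replace e := D.unroll_inj.2 e <;> simp at e
  exact e ▸ h

theorem right_mem_tame {a : D} (h : a ∈ tame) : D.right a ∈ tame := by
  refine mem_tame ⟨fun _ _ e => ?_, fun _ e => ?_, fun _ e => ?_, fun _ _ e => ?_⟩ <;>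
    replace e := D.unroll_inj.2 e <;> simp at e
  exact e ▸ h

theorem pair_mem_tame {a b : D} (ha : a ∈ tame) (hb : b ∈ tame) : D.pair a b ∈ tame := by
  refine mem_tame ⟨fun _ _ e => ?_, fun _ e => ?_, fun _ e => ?_, fun _ _ e => ?_⟩ <;>
    replace e := D.unroll_inj.2 e <;> simp at e
  exact ⟨e.1 ▸ ha, e.2 ▸ hb⟩

theorem amb_mem_tame {a b : D} (ha : a ∈ tame) (hb : b ∈ tame) (ha' : a ∈ nonAmb)
    (hb' : b ∈ nonAmb) : D.amb a b ∈ tame := by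
  refine mem_tame ⟨fun _ _ e => ?_, fun _ e => ?_, fun _ e => ?_, fun _ _ e => ?_⟩ <;>
    replace e := D.unroll_inj.2 e <;> simp at e
  obtain ⟨rfl, rfl⟩ := e
  exact ⟨⟨ha', hb'⟩, ha, hb⟩

/-- Both claims are proved together: for `A(ρ)`, tameness needs the elements of the determined type
`ρ` not to begin with `Amb`. A fixed point is an intersection of subdomains closed under the body,
so it suffices to exhibit one such subdomain inside the desired set. -/
theorem tden_subset {n : ℕ} (ρ : Ty n) (hρ : ρ.Regular) (ζ : Fin n → Set D) (hζ : ∀ i, ζ i ⊆ tame) :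
    tden ρ ζ ⊆ tame ∧ (ρ.Determined → tden ρ ζ ⊆ nonAmb) := by
  have hb : (⊥ : D) ∈ tame := bot_mem_tame
  have hb' : (⊥ : D) ∈ nonAmb := fun b c => by simp [← D.unroll_inj]
  induction ρ with
  | var i => exact ⟨hζ i, fun h => by cases h⟩
  | one =>
    constructor
    · rintro _ (rfl | rfl)
      · exact mem_tame (by simp [TameStep, ← D.unroll_inj])
      · exact hb
    · rintro - _ (rfl | rfl)
      · exact fun b c => by simp [← D.unroll_inj]
      · exact hb'
  | prod ρ σ ihρ ihσ =>
    have h1 := (ihρ hρ.1 ζ hζ).1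
    have h2 := (ihσ hρ.2 ζ hζ).1
    constructor
    · rintro _ (⟨a, ha, b, hb, rfl⟩ | rfl)
      · exact pair_mem_tame (h1 ha) (h2 hb)
      · exact hb
    · rintro - _ (⟨a, ha, b, hb, rfl⟩ | rfl)
      · exact fun b c => by simp [← D.unroll_inj]
      · exact hb'
  | sum ρ σ ihρ ihσ =>
    have h1 := (ihρ hρ.1 ζ hζ).1
    have h2 := (ihσ hρ.2 ζ hζ).1
    constructor
    · rintro _ ((⟨a, ha, rfl⟩ | ⟨a, ha, rfl⟩) | rfl)
      · exact left_mem_tame (h1 ha)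
      · exact right_mem_tame (h2 ha)
      · exact hb
    · rintro - _ ((⟨a, ha, rfl⟩ | ⟨a, ha, rfl⟩) | rfl)
      · exact fun b c => by simp [← D.unroll_inj]
      · exact fun b c => by simp [← D.unroll_inj]
      · exact hb'
  | arrow ρ σ ihρ ihσ =>
    constructor
    · rintro _ (⟨f, -, rfl⟩ | rfl)
      · exact mem_tame (by simp [TameStep, ← D.unroll_inj])
      · exact hb
    · rintro - _ (⟨f, -, rfl⟩ | rfl)
      · exact fun b c => by simp [← D.unroll_inj]
      · exact hb'
  | fix ρ ih =>
    constructor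
    · refine Set.sInter_subset_of_mem ⟨isSubdomain_tame, (ih hρ.2 _ ?_).1⟩
      exact fun i => Fin.cases subset_rfl hζ i
    · rintro (_ | _ | _ | _ | h)
      -- The intersection with `tame` is taken because the induction hypothesis asks for
      -- environments inside `tame`.
      have h' := ih hρ.2 (ext ζ (tame ∩ nonAmb)) (fun i => Fin.cases Set.inter_subset_left hζ i)
      have hX : tden (.fix ρ) ζ ⊆ tame ∩ nonAmb := Set.sInter_subset_of_mem
        ⟨isSubdomain_tame.inter isSubdomain_nonAmb, Set.subset_inter h'.1 (h'.2 h)⟩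
      exact hX.trans Set.inter_subset_right
  | amb ρ ih =>
    have h := ih hρ.2 ζ hζ
    refine ⟨?_, fun h => by cases h⟩
    rintro _ (⟨a, ha, b, hb, rfl⟩ | rfl)
    · exact amb_mem_tame (h.1 ha) (h.1 hb) (h.2 hρ.1 ha) (h.2 hρ.1 hb)
    · exact hb

theorem tval_subset_tame {ρ : Ty 0} (hρ : ρ.Regular) : tval ρ ⊆ tame :=
  (tden_subset ρ hρ _ fun i => i.elim0).1

/-! ## Inversion of `data` -/

theorem DataStep.mono {R R' : D → D → Prop} (h : ∀ x y, R x y → R' x y) {a d : D}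
    (had : DataStep R a d) : DataStep R' a d := by
  rcases had with ⟨x, y, e, hx, k⟩ | ⟨x, y, e, hx, k⟩ | k | k | ⟨x, y, e, e', k⟩ |
    ⟨x, y, e, e', k⟩ | ⟨x, y, x', y', e, e', k, k'⟩ | k | k
  · exact Or.inl ⟨x, y, e, hx, h _ _ k⟩
  · exact Or.inr (Or.inl ⟨x, y, e, hx, h _ _ k⟩)
  · exact Or.inr (Or.inr (Or.inl k))
  · exact Or.inr (Or.inr (Or.inr (Or.inl k)))
  · exact Or.inr (Or.inr (Or.inr (Or.inr (Or.inl ⟨x, y, e, e', h _ _ k⟩))))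
  · exact Or.inr (Or.inr (Or.inr (Or.inr (Or.inr (Or.inl ⟨x, y, e, e', h _ _ k⟩)))))
  · exact Or.inr (Or.inr (Or.inr (Or.inr (Or.inr (Or.inr (Or.inl
      ⟨x, y, x', y', e, e', h _ _ k, h _ _ k'⟩))))))
  · exact Or.inr (Or.inr (Or.inr (Or.inr (Or.inr (Or.inr (Or.inr (Or.inl k)))))))
  · exact Or.inr (Or.inr (Or.inr (Or.inr (Or.inr (Or.inr (Or.inr (Or.inr k)))))))

theorem dataStep_of_mem_data {a d : D} (h : d ∈ data a) : DataStep (fun x y => y ∈ data x) a d := by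
  obtain ⟨R, hR, had⟩ := h
  exact (hR a d had).mono fun x y h => ⟨R, hR, h⟩

/-- By monotonicity one application of the operator to the largest post-fixed point is again a
post-fixed point. -/
theorem mem_data_of_dataStep {a d : D} (h : DataStep (fun x y => y ∈ data x) a d) : d ∈ data a := by
  have hs : ∀ x y, y ∈ data x → DataStep (fun x y => y ∈ data x) x y :=
    fun x y => dataStep_of_mem_data
  exact ⟨DataStep fun x y => y ∈ data x, fun x y hxy => hxy.mono hs, h⟩

theorem left_mem_data {a d : D} (h : d ∈ data a) : D.left d ∈ data (D.left a) :=
  mem_data_of_dataStep (Or.inr (Or.inr (Or.inr (Or.inr (Or.inl ⟨a, d, rfl, rfl, h⟩)))))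

theorem right_mem_data {a d : D} (h : d ∈ data a) : D.right d ∈ data (D.right a) :=
  mem_data_of_dataStep (Or.inr (Or.inr (Or.inr (Or.inr (Or.inr (Or.inl ⟨a, d, rfl, rfl, h⟩))))))

theorem pair_mem_data {a b d e : D} (h : d ∈ data a) (k : e ∈ data b) :
    D.pair d e ∈ data (D.pair a b) :=
  mem_data_of_dataStep (Or.inr (Or.inr (Or.inr (Or.inr (Or.inr (Or.inr (Or.inl
    ⟨a, b, d, e, rfl, rfl, h, k⟩)))))))

namespace DataStep

variable {R : D → D → Prop} {a b d : D}

theorem of_bot (h : DataStep R ⊥ d) : d = ⊥ := by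
  simp only [DataStep, ← D.unroll_inj (a := ⊥)] at h
  simpa [D.unroll_inj] using h

theorem of_nil (h : DataStep R D.nil d) : d = D.nil := by
  simp only [DataStep, ← D.unroll_inj (a := D.nil)] at h
  simpa [D.unroll_inj] using h

theorem of_fn {f : SMap D D} (h : DataStep R (D.fn f) d) : d = D.fn f := by
  simp only [DataStep, ← D.unroll_inj (a := D.fn _)] at h
  simpa [D.unroll_inj] using h

theorem of_left (h : DataStep R (D.left a) d) : ∃ d', d = D.left d' ∧ R a d' := by
  simp only [DataStep, ← D.unroll_inj (a := D.left _)] at h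
  simpa using h

theorem of_right (h : DataStep R (D.right a) d) : ∃ d', d = D.right d' ∧ R a d' := by
  simp only [DataStep, ← D.unroll_inj (a := D.right _)] at h
  simpa using h

theorem of_pair (h : DataStep R (D.pair a b) d) :
    ∃ d₁ d₂, d = D.pair d₁ d₂ ∧ R a d₁ ∧ R b d₂ := by
  simp only [DataStep, ← D.unroll_inj (a := D.pair _ _)] at h
  simpa using h

theorem of_amb (h : DataStep R (D.amb a b) d) :
    a ≠ ⊥ ∧ R a d ∨ b ≠ ⊥ ∧ R b d ∨ a = ⊥ ∧ b = ⊥ ∧ d = ⊥ := by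
  simp only [DataStep, ← D.unroll_inj (a := D.amb _ _)] at h
  simpa [and_assoc] using h

end DataStep

/-! ## Denotation and observation of closed programs -/

theorem val_nil : val .nil = D.nil := by simp only [val, den]
theorem val_left (M : Prog 0) : val (.left M) = D.left (val M) := by simp only [val, den]
theorem val_right (M : Prog 0) : val (.right M) = D.right (val M) := by simp only [val, den]
theorem val_pair (M N : Prog 0) : val (.pair M N) = D.pair (val M) (val N) := by
  simp only [val, den]
theorem val_amb (M N : Prog 0) : val (.amb M N) = D.amb (val M) (val N) := by
  simp only [val, den]
theorem exists_val_lam (M : Prog 1) : ∃ f, val (.lam M) = D.fn f :=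
  ⟨_, by simp only [val, den]; rfl⟩
theorem val_ne_bot {M : Prog 0} (h : Whnf M) : val M ≠ ⊥ := den_ne_bot_of_whnf h _

theorem obs_nil : obs .nil = D.nil := by simp only [obs, obsEnv]
theorem obs_left (M : Prog 0) : obs (.left M) = D.left (obs M) := by simp only [obs, obsEnv]
theorem obs_right (M : Prog 0) : obs (.right M) = D.right (obs M) := by simp only [obs, obsEnv]
theorem obs_pair (M N : Prog 0) : obs (.pair M N) = D.pair (obs M) (obs N) := by
  simp only [obs, obsEnv]
theorem obs_amb (M N : Prog 0) : obs (.amb M N) = ⊥ := by simp only [obs, obsEnv]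
theorem obs_lam (M : Prog 1) : obs (.lam M) = val (.lam M) := by simp only [obs, obsEnv, val]

theorem obs_of_not_whnf {M : Prog 0} (h : ¬ Whnf M) : obs M = ⊥ := by
  cases M with
  | var i => exact i.elim0
  | lam M => exact absurd (.lam M) h
  | nil => exact absurd (.con .nil) h
  | left M => exact absurd (.con (.left M)) h
  | right M => exact absurd (.con (.right M)) h
  | pair M N => exact absurd (.con (.pair M N)) h
  | amb M N => exact absurd (.con (.amb M N)) h
  | _ => simp only [obs, obsEnv]

/-- Induction on closed programs up to weak head normal form. -/
theorem closed_induction {p : Prog 0 → Prop} (nil : p .nil) (left : ∀ M, p M → p (.left M))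
    (right : ∀ M, p M → p (.right M)) (pair : ∀ M N, p M → p N → p (.pair M N))
    (amb : ∀ M N, p (.amb M N)) (lam : ∀ M, p (.lam M)) (other : ∀ M, ¬ Whnf M → p M)
    (M : Prog 0) : p M := by
  by_cases h : Whnf M
  · cases h with
    | lam M => exact lam M
    | con h =>
      cases h with
      | nil => exact nil
      | left M => exact left M (closed_induction nil left right pair amb lam other M)
      | right M => exact right M (closed_induction nil left right pair amb lam other M)
      | pair M N =>
        exact pair M N (closed_induction nil left right pair amb lam other M)
          (closed_induction nil left right pair amb lam other N)
      | amb M N => exact amb M N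
  · exact other M h
termination_by sizeOf M

/-- Such a step starts at `Amb` or at a program that is not a w.h.n.f., and neither shows any data
yet. -/
theorem obs_eq_bot_of_choiceStep {c : ChoiceRule} {M M' : Prog 0} (h : ChoiceStep c M M') :
    obs M = ⊥ := by
  cases h with
  | head h => exact obs_of_not_whnf fun hw => not_red_of_whnf hw h
  | _ => exact obs_amb _ _

theorem obs_mono {r : ParRule} {M M' : Prog 0} (h : ParStep r M M') : obs M ≤ obs M' := by
  induction M using closed_induction generalizing r M' with
  | nil => cases h with
    | choice h => rw [obs_eq_bot_of_choiceStep h]; exact bot_le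
    | nil => exact le_rfl
  | left M ih => cases h with
    | choice h => rw [obs_eq_bot_of_choiceStep h]; exact bot_le
    | left h => rw [obs_left, obs_left]; exact D.left_le_left.2 (ih h)
  | right M ih => cases h with
    | choice h => rw [obs_eq_bot_of_choiceStep h]; exact bot_le
    | right h => rw [obs_right, obs_right]; exact D.right_le_right.2 (ih h)
  | pair M N ihM ihN => cases h with
    | choice h => rw [obs_eq_bot_of_choiceStep h]; exact bot_le
    | pair h k => rw [obs_pair, obs_pair]; exact D.pair_le_pair.2 ⟨ihM h, ihN k⟩
  | amb M N => rw [obs_amb]; exact bot_le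
  | lam M => cases h with
    | choice h => rw [obs_eq_bot_of_choiceStep h]; exact bot_le
    | lam => exact le_rfl
  | other M hM => rw [obs_of_not_whnf hM]; exact bot_le

/-! ## The strategy -/

/-- `M` reaches a weak head normal form in `n` steps. -/
inductive HaltsIn : ℕ → Prog 0 → Prop
  | zero {M : Prog 0} (h : Whnf M) : HaltsIn 0 M
  | succ {n : ℕ} {M M' : Prog 0} (h : Red M M') (k : HaltsIn n M') : HaltsIn (n + 1) M

theorem exists_haltsIn {M : Prog 0} (h : val M ≠ ⊥) : ∃ n, HaltsIn n M := by
  obtain ⟨W, hW, hs⟩ := exists_steps_whnf h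
  clear h
  induction hs using Relation.ReflTransGen.head_induction_on with
  | refl => exact ⟨0, .zero hW⟩
  | head h _ ih => exact ih.imp' (· + 1) fun n hn => .succ h hn

/-- The length of a shortest reduction to weak head normal form. -/
noncomputable def rank (M : Prog 0) : ℕ := sInf {n | HaltsIn n M}

/-- A reduction step along a shortest path to weak head normal form, if there is one. -/
def Toward (M M' : Prog 0) : Prop := Red M M' ∧ (val M ≠ ⊥ → rank M' < rank M)

/-- The first step of a shortest reduction lowers the distance. If the value is `⊥` nothing is
required beyond a step. -/
theorem exists_toward {M : Prog 0} (h : ¬ Whnf M) : ∃ M', Toward M M' := by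
  by_cases hb : val M = ⊥
  · obtain ⟨M', h'⟩ := exists_red_of_not_whnf h
    exact ⟨M', h', fun hb' => absurd hb hb'⟩
  · have hr : HaltsIn (rank M) M := Nat.sInf_mem (exists_haltsIn hb)
    generalize hn : rank M = n at hr
    cases hr with
    | zero hw => exact absurd hw h
    | @succ n _ M' h' k =>
      refine ⟨M', h', fun _ => ?_⟩
      rw [hn]
      exact Nat.lt_succ_of_le (Nat.sInf_le k)

theorem not_whnf_of_val_eq_bot {M : Prog 0} (h : val M = ⊥) : ¬ Whnf M := fun hw => val_ne_bot hw h

/-- An argument of `Amb` that may be chosen in order to compute `d`. -/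
def Eligible (d : D) (M : Prog 0) : Prop := val M ≠ ⊥ ∧ d ∈ data (val M)

/-- Reduction preserves values, so a side on which the strategy has started to work remains the
chosen one. -/
theorem Eligible.red {d : D} {M M' : Prog 0} (h : Eligible d M) (hr : Red M M') :
    Eligible d M' := by
  rwa [Eligible, ← val_eq_of_red hr]

/-- The steps of a computation of `d` at time `i`: reduce to weak head normal form on a shortest
path; in `Amb`, work on the left argument if it is eligible, otherwise on the right argument if it
is eligible, and alternate between the arguments if both have the denotation `⊥`. -/
inductive Strat : ℕ → D → ParRule → Prog 0 → Prog 0 → Prop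
  | nil (i : ℕ) : Strat i D.nil .nil .nil .nil
  | lam (i : ℕ) (d : D) (M : Prog 1) : Strat i d .lam (.lam M) (.lam M)
  | left {i : ℕ} {d : D} {r : ParRule} {M M' : Prog 0} (h : Strat i d r M M') :
      Strat i d.left (.left r) (.left M) (.left M')
  | right {i : ℕ} {d : D} {r : ParRule} {M M' : Prog 0} (h : Strat i d r M M') :
      Strat i d.right (.right r) (.right M) (.right M')
  | pair {i : ℕ} {d e : D} {r s : ParRule} {M M' N N' : Prog 0} (h : Strat i d r M M')
      (k : Strat i e s N N') : Strat i (d.pair e) (.pair r s) (.pair M N) (.pair M' N')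
  | head {i : ℕ} {d : D} {M M' : Prog 0} (hM : ¬ Whnf M) (h : Toward M M') :
      Strat i d (.choice .head) M M'
  | redLeft {i : ℕ} {d : D} {L L' : Prog 0} (hL : Eligible d L) (h : Toward L L')
      (R : Prog 0) : Strat i d (.choice .redLeft) (.amb L R) (.amb L' R)
  | pickLeft {i : ℕ} {d : D} {L : Prog 0} (hL : Eligible d L) (h : Whnf L) (R : Prog 0) :
      Strat i d (.choice .pickLeft) (.amb L R) L
  | redRight {i : ℕ} {d : D} {L R R' : Prog 0} (hL : ¬ Eligible d L) (hR : Eligible d R)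
      (h : Toward R R') : Strat i d (.choice .redRight) (.amb L R) (.amb L R')
  | pickRight {i : ℕ} {d : D} {L R : Prog 0} (hL : ¬ Eligible d L) (hR : Eligible d R)
      (h : Whnf R) : Strat i d (.choice .pickRight) (.amb L R) R
  | altLeft {i : ℕ} (hi : Even i) {L L' R : Prog 0} (hL : val L = ⊥) (hR : val R = ⊥)
      (h : Toward L L') : Strat i ⊥ (.choice .redLeft) (.amb L R) (.amb L' R)
  | altRight {i : ℕ} (hi : ¬ Even i) {L R R' : Prog 0} (hL : val L = ⊥) (hR : val R = ⊥)
      (h : Toward R R') : Strat i ⊥ (.choice .redRight) (.amb L R) (.amb L R')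

theorem Strat.parStep {i : ℕ} {d : D} {r : ParRule} {M M' : Prog 0} (h : Strat i d r M M') :
    ParStep r M M' := by
  induction h with
  | nil => exact .nil
  | lam d M => exact .lam M
  | left _ ih => exact .left ih
  | right _ ih => exact .right ih
  | pair _ _ ih ih' => exact .pair ih ih'
  | head _ h => exact .choice (.head h.1)
  | redLeft _ h R => exact .choice (.redLeft h.1 R)
  | pickLeft _ h R => exact .choice (.pickLeft h R)
  | redRight _ _ h => exact .choice (.redRight _ h.1)
  | pickRight _ _ h => exact .choice (.pickRight _ h)
  | altLeft _ _ _ h => exact .choice (.redLeft h.1 _)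
  | altRight _ _ _ h => exact .choice (.redRight _ h.1)

/-! ### The invariant of the strategy -/

/-- The closed programs `M` that can compute `d`. -/
def Goal (d : D) (M : Prog 0) : Prop := d ∈ data (val M) ∧ val M ∈ tame

namespace Goal

variable {d : D} {M N L R : Prog 0}

theorem dataStep (h : Goal d M) : DataStep (fun x y => y ∈ data x) (val M) d :=
  dataStep_of_mem_data h.1

theorem nil (h : Goal d .nil) : d = D.nil := (val_nil ▸ h.dataStep).of_nil

theorem lam {M : Prog 1} (h : Goal d (.lam M)) : d = obs (.lam M) := by
  obtain ⟨f, hf⟩ := exists_val_lam M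
  rw [obs_lam, hf]
  exact (hf ▸ h.dataStep).of_fn

theorem left (h : Goal d (.left M)) : ∃ d', d = D.left d' ∧ Goal d' M := by
  obtain ⟨d', e, hd⟩ := (val_left M ▸ h.dataStep).of_left
  exact ⟨d', e, hd, (tameStep_of_mem_tame h.2).2.1 _ (val_left M)⟩

theorem right (h : Goal d (.right M)) : ∃ d', d = D.right d' ∧ Goal d' M := by
  obtain ⟨d', e, hd⟩ := (val_right M ▸ h.dataStep).of_right
  exact ⟨d', e, hd, (tameStep_of_mem_tame h.2).2.2.1 _ (val_right M)⟩

theorem pair (h : Goal d (.pair M N)) :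
    ∃ d₁ d₂, d = D.pair d₁ d₂ ∧ Goal d₁ M ∧ Goal d₂ N := by
  obtain ⟨d₁, d₂, e, h1, h2⟩ := (val_pair M N ▸ h.dataStep).of_pair
  have ht := (tameStep_of_mem_tame h.2).2.2.2 _ _ (val_pair M N)
  exact ⟨d₁, d₂, e, ⟨h1, ht.1⟩, ⟨h2, ht.2⟩⟩

theorem amb (h : Goal d (.amb L R)) :
    Eligible d L ∨ Eligible d R ∨ val L = ⊥ ∧ val R = ⊥ ∧ d = ⊥ :=
  (val_amb L R ▸ h.dataStep).of_amb

theorem tame_amb (h : Goal d (.amb L R)) :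
    (val L ∈ nonAmb ∧ val R ∈ nonAmb) ∧ val L ∈ tame ∧ val R ∈ tame :=
  (tameStep_of_mem_tame h.2).1 _ _ (val_amb L R)

theorem eq_bot (h : Goal d M) (hM : val M = ⊥) : d = ⊥ := (hM ▸ h.dataStep).of_bot

theorem of_val_eq (h : Goal d M) (e : val M = val N) : Goal d N := by rwa [Goal, ← e]

theorem of_red_left {L' : Prog 0} (h : Goal d (.amb L R)) (hr : Red L L') :
    Goal d (.amb L' R) :=
  h.of_val_eq (by rw [val_amb, val_amb, val_eq_of_red hr])

theorem of_red_right {R' : Prog 0} (h : Goal d (.amb L R)) (hr : Red R R') :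
    Goal d (.amb L R') :=
  h.of_val_eq (by rw [val_amb, val_amb, val_eq_of_red hr])

/-- Data follows the data constructors and leaves functions unchanged, so every evaluated part
already agrees with `d`; all other parts are observed as `⊥`. -/
theorem obs_le (h : Goal d M) : obs M ≤ d := by
  induction M using closed_induction generalizing d with
  | nil => rw [h.nil, obs_nil]
  | left M ih =>
    obtain ⟨d', rfl, h'⟩ := h.left
    rw [obs_left]
    exact D.left_le_left.2 (ih h')
  | right M ih =>
    obtain ⟨d', rfl, h'⟩ := h.right
    rw [obs_right]
    exact D.right_le_right.2 (ih h')
  | pair M N ihM ihN =>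
    obtain ⟨d₁, d₂, rfl, h1, h2⟩ := h.pair
    rw [obs_pair]
    exact D.pair_le_pair.2 ⟨ihM h1, ihN h2⟩
  | amb M N => rw [obs_amb]; exact bot_le
  | lam M => exact h.lam.ge
  | other M hM => rw [obs_of_not_whnf hM]; exact bot_le

theorem exists_strat (h : Goal d M) (i : ℕ) : ∃ r M', Strat i d r M M' := by
  induction M using closed_induction generalizing d with
  | nil =>
    rw [h.nil]
    exact ⟨_, _, .nil i⟩
  | left M ih =>
    obtain ⟨d', rfl, h'⟩ := h.left
    obtain ⟨r, M', hs⟩ := ih h'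
    exact ⟨_, _, .left hs⟩
  | right M ih =>
    obtain ⟨d', rfl, h'⟩ := h.right
    obtain ⟨r, M', hs⟩ := ih h'
    exact ⟨_, _, .right hs⟩
  | pair M N ihM ihN =>
    obtain ⟨d₁, d₂, rfl, h1, h2⟩ := h.pair
    obtain ⟨r, M', hs⟩ := ihM h1
    obtain ⟨r', N', hs'⟩ := ihN h2
    exact ⟨_, _, .pair hs hs'⟩
  | amb L R =>
    by_cases hL : Eligible d L
    · by_cases hw : Whnf L
      · exact ⟨_, _, .pickLeft hL hw R⟩
      · obtain ⟨L', h'⟩ := exists_toward hw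
        exact ⟨_, _, .redLeft hL h' R⟩
    -- The clauses of data at `Amb` match the branches of the strategy, which therefore never gets
    -- stuck.
    · rcases h.amb with h | hR | ⟨h1, h2, rfl⟩
      · exact absurd h hL
      · by_cases hw : Whnf R
        · exact ⟨_, _, .pickRight hL hR hw⟩
        · obtain ⟨R', h'⟩ := exists_toward hw
          exact ⟨_, _, .redRight hL hR h'⟩
      · by_cases hi : Even i
        · obtain ⟨L', h'⟩ := exists_toward (not_whnf_of_val_eq_bot h1)
          exact ⟨_, _, .altLeft hi h1 h2 h'⟩
        · obtain ⟨R', h'⟩ := exists_toward (not_whnf_of_val_eq_bot h2)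
          exact ⟨_, _, .altRight hi h1 h2 h'⟩
  | lam M => exact ⟨_, _, .lam i d M⟩
  | other M hM =>
    obtain ⟨M', h'⟩ := exists_toward hM
    exact ⟨_, _, .head hM h'⟩

end Goal

/-- Reduction steps do not change the value. When an argument is picked, eligibility places `d` in
its data, and tameness passes to it from the `Amb`. -/
theorem Goal.strat {i : ℕ} {d : D} {r : ParRule} {M M' : Prog 0} (h : Goal d M)
    (hs : Strat i d r M M') : Goal d M' := by
  induction hs with
  | nil => exact h
  | lam d M => exact h
  | left _ ih =>
    obtain ⟨d', e, h'⟩ := h.left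
    have h2 := ih (D.left_inj.1 e ▸ h')
    exact ⟨val_left _ ▸ left_mem_data h2.1, val_left _ ▸ left_mem_tame h2.2⟩
  | right _ ih =>
    obtain ⟨d', e, h'⟩ := h.right
    have h2 := ih (D.right_inj.1 e ▸ h')
    exact ⟨val_right _ ▸ right_mem_data h2.1, val_right _ ▸ right_mem_tame h2.2⟩
  | pair _ _ ih ih' =>
    obtain ⟨d₁, d₂, e, h1, h2⟩ := h.pair
    have k1 := ih ((D.pair_inj.1 e).1 ▸ h1)
    have k2 := ih' ((D.pair_inj.1 e).2 ▸ h2)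
    exact ⟨val_pair _ _ ▸ pair_mem_data k1.1 k2.1, val_pair _ _ ▸ pair_mem_tame k1.2 k2.2⟩
  | head _ hr => exact h.of_val_eq (val_eq_of_red hr.1)
  | redLeft _ hr R => exact h.of_red_left hr.1
  | pickLeft hL _ R => exact ⟨hL.2, h.tame_amb.2.1⟩
  | redRight _ _ hr => exact h.of_red_right hr.1
  | pickRight _ hR _ => exact ⟨hR.2, h.tame_amb.2.2⟩
  | altLeft _ _ _ hr => exact h.of_red_left hr.1
  | altRight _ _ _ hr => exact h.of_red_right hr.1

/-! ### Inversion of the steps of the strategy -/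

namespace Strat

variable {i : ℕ} {d : D} {r : ParRule} {M M' N N' : Prog 0}

theorem of_left (h : Strat i d r (.left N) M') :
    ∃ d' s N', d = D.left d' ∧ r = .left s ∧ M' = .left N' ∧ Strat i d' s N N' := by
  cases h with
  | left h => exact ⟨_, _, _, rfl, rfl, rfl, h⟩
  | head hM _ => exact absurd (.con (.left N)) hM

theorem of_right (h : Strat i d r (.right N) M') :
    ∃ d' s N', d = D.right d' ∧ r = .right s ∧ M' = .right N' ∧ Strat i d' s N N' := by
  cases h with
  | right h => exact ⟨_, _, _, rfl, rfl, rfl, h⟩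
  | head hM _ => exact absurd (.con (.right N)) hM

theorem of_pair (h : Strat i d r (.pair M N) M') :
    ∃ d₁ d₂ s₁ s₂ M₁ M₂, d = D.pair d₁ d₂ ∧ r = .pair s₁ s₂ ∧ M' = .pair M₁ M₂ ∧
      Strat i d₁ s₁ M M₁ ∧ Strat i d₂ s₂ N M₂ := by
  cases h with
  | pair h k => exact ⟨_, _, _, _, _, _, rfl, rfl, rfl, h, k⟩
  | head hM _ => exact absurd (.con (.pair M N)) hM

theorem of_not_whnf (h : Strat i d r M M') (hM : ¬ Whnf M) : Toward M M' := by
  cases h with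
  | head _ h => exact h
  | lam => exact absurd (.lam _) hM
  | _ => exact absurd (.con (by constructor)) hM

/-- Two clauses carry the rule `redLeft`: work on an eligible argument, whose value is not `⊥`, and
the alternating clause, which fires at even times. -/
theorem of_redLeft {L L' R : Prog 0} (h : Strat i d (.choice .redLeft) (.amb L R) (.amb L' R)) :
    Toward L L' ∧ (val L = ⊥ → Even i) := by
  generalize hM : Prog.amb L R = M, hM' : Prog.amb L' R = M' at h
  generalize hr : ParRule.choice .redLeft = r at h
  cases h <;> cases hr
  · cases hM; cases hM'
    rename_i hL h
    exact ⟨h, fun hb => absurd hb hL.1⟩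
  · cases hM; cases hM'
    rename_i hi _ _ h
    exact ⟨h, fun _ => hi⟩

theorem of_redRight {L R R' : Prog 0} (h : Strat i d (.choice .redRight) (.amb L R) (.amb L R')) :
    Toward R R' ∧ (val R = ⊥ → ¬ Even i) := by
  generalize hM : Prog.amb L R = M, hM' : Prog.amb L R' = M' at h
  generalize hr : ParRule.choice .redRight = r at h
  cases h <;> cases hr
  · cases hM; cases hM'
    rename_i _ hR h
    exact ⟨h, fun hb => absurd hb hR.1⟩
  · cases hM; cases hM'
    rename_i hi _ _ h
    exact ⟨h, fun _ => hi⟩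

theorem of_eligible_left {L R : Prog 0} (h : Strat i d r (.amb L R) M') (hL : Eligible d L) :
    (∃ L', M' = .amb L' R ∧ Toward L L') ∨ Whnf L ∧ M' = L := by
  cases h with
  | head hM _ => exact absurd (.con (.amb L R)) hM
  | redLeft _ h => exact Or.inl ⟨_, rfl, h⟩
  | pickLeft _ h => exact Or.inr ⟨h, rfl⟩
  | redRight hL' => exact absurd hL hL'
  | pickRight hL' => exact absurd hL hL'
  | altLeft _ hb => exact absurd hb hL.1
  | altRight _ hb => exact absurd hb hL.1

theorem of_eligible_right {L R : Prog 0} (h : Strat i d r (.amb L R) M') (hL : ¬ Eligible d L)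
    (hR : Eligible d R) : (∃ R', M' = .amb L R' ∧ Toward R R') ∨ Whnf R ∧ M' = R := by
  cases h with
  | head hM _ => exact absurd (.con (.amb L R)) hM
  | redLeft hL' => exact absurd hL' hL
  | pickLeft hL' => exact absurd hL' hL
  | redRight _ _ h => exact Or.inl ⟨_, rfl, h⟩
  | pickRight _ _ h => exact Or.inr ⟨h, rfl⟩
  | altLeft _ _ hb => exact absurd hb hR.1
  | altRight _ _ hb => exact absurd hb hR.1

end Strat

/-! ### Infinite runs: fairness and convergence -/

/-- An infinite sequence of steps that follow the strategy from time `k` on. -/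
structure Run (k : ℕ) (d : D) (P : ℕ → Prog 0) (r : ℕ → ParRule) : Prop where
  goal : Goal d (P 0)
  step : ∀ i, Strat (k + i) d (r i) (P i) (P (i + 1))

theorem exists_run {d : D} {M : Prog 0} (h : Goal d M) : ∃ P r, P 0 = M ∧ Run 0 d P r := by
  choose r N hs using fun (x : {N // Goal d N}) (i : ℕ) => x.2.exists_strat i
  -- Each program is carried along with its invariant, from which the next step is obtained.
  let Q : ℕ → {N // Goal d N} := fun n =>
    Nat.rec ⟨M, h⟩ (fun i x => ⟨N x i, x.2.strat (hs x i)⟩) n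
  refine ⟨fun i => (Q i).1, fun i => r (Q i) i, rfl, h, fun i => ?_⟩
  rw [Nat.zero_add]
  exact hs (Q i) i

/-- A reduction towards weak head normal form cannot go on forever. -/
theorem val_eq_bot_of_forall_toward {L : ℕ → Prog 0} (h : ∀ i, Toward (L i) (L (i + 1))) (i : ℕ) :
    val (L i) = ⊥ := by
  have hv : ∀ i, val (L i) = val (L 0) := by
    intro i
    induction i with
    | zero => rfl
    | succ i ih => rw [← ih, val_eq_of_red (h i).1]
  rw [hv]
  by_contra hb
  have hr : ∀ i, rank (L i) + i ≤ rank (L 0) := by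
    intro i
    induction i with
    | zero => exact le_rfl
    | succ i ih =>
      have := (h i).2 (by rwa [hv])
      omega
  have := hr (rank (L 0) + 1)
  omega

namespace Run

variable {k : ℕ} {d : D} {P : ℕ → Prog 0} {r : ℕ → ParRule}

/-- The alternation depends on the time, so the tail of a run is a run whose clock starts one later;
the parameter `k` records this. -/
theorem tail (h : Run k d P r) : Run (k + 1) d (fun i => P (i + 1)) fun i => r (i + 1) :=
  ⟨h.goal.strat (h.step 0), fun i => by
    have := h.step (i + 1)
    rwa [show k + (i + 1) = k + 1 + i by omega] at this⟩

theorem drop (h : Run k d P r) (j : ℕ) : Run (k + j) d (fun i => P (i + j)) fun i => r (i + j) := by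
  induction j with
  | zero => exact h
  | succ j ih =>
    have := ih.tail
    simp only [show ∀ i, i + 1 + j = i + (j + 1) by omega] at this
    exact this

theorem goal_at (h : Run k d P r) (j : ℕ) : Goal d (P j) := by
  have := (h.drop j).goal
  rwa [Nat.zero_add] at this

theorem parStep (h : Run k d P r) (i : ℕ) : ParStep (r i) (P i) (P (i + 1)) := (h.step i).parStep

theorem obs_mono (h : Run k d P r) : Monotone fun i => obs (P i) :=
  monotone_nat_of_le_succ fun i => AmbLang.obs_mono (h.parStep i)

/-- A data constructor at the head stays there, since the strategy offers only the congruence step.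
The run is thus a run of the argument with the same clock and the matching component of `d`. -/
theorem exists_left (h : Run k d P r) {N : Prog 0} (h0 : P 0 = .left N) :
    ∃ d' Q s, d = D.left d' ∧ (∀ i, P i = .left (Q i)) ∧ (∀ i, r i = .left (s i)) ∧
      Run k d' Q s := by
  have hP : ∀ i, ∃ N, P i = .left N := by
    intro i
    induction i with
    | zero => exact ⟨N, h0⟩
    | succ i ih =>
      obtain ⟨N, hN⟩ := ih
      obtain ⟨_, _, N', -, -, e, -⟩ := (hN ▸ h.step i).of_left
      exact ⟨N', e⟩
  choose Q hQ using hP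
  obtain ⟨d', rfl, hg⟩ := (hQ 0 ▸ h.goal).left
  have hs : ∀ i, ∃ s, r i = .left s ∧ Strat (k + i) d' s (Q i) (Q (i + 1)) := by
    intro i
    have hi := h.step i
    rw [hQ i, hQ (i + 1)] at hi
    obtain ⟨d'', s, N', e1, e2, e3, hs⟩ := hi.of_left
    cases D.left_inj.1 e1
    cases e3
    exact ⟨s, e2, hs⟩
  choose s hr hs using hs
  exact ⟨d', Q, s, rfl, hQ, hr, hg, hs⟩

theorem exists_right (h : Run k d P r) {N : Prog 0} (h0 : P 0 = .right N) :
    ∃ d' Q s, d = D.right d' ∧ (∀ i, P i = .right (Q i)) ∧ (∀ i, r i = .right (s i)) ∧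
      Run k d' Q s := by
  have hP : ∀ i, ∃ N, P i = .right N := by
    intro i
    induction i with
    | zero => exact ⟨N, h0⟩
    | succ i ih =>
      obtain ⟨N, hN⟩ := ih
      obtain ⟨_, _, N', -, -, e, -⟩ := (hN ▸ h.step i).of_right
      exact ⟨N', e⟩
  choose Q hQ using hP
  obtain ⟨d', rfl, hg⟩ := (hQ 0 ▸ h.goal).right
  have hs : ∀ i, ∃ s, r i = .right s ∧ Strat (k + i) d' s (Q i) (Q (i + 1)) := by
    intro i
    have hi := h.step i
    rw [hQ i, hQ (i + 1)] at hi
    obtain ⟨d'', s, N', e1, e2, e3, hs⟩ := hi.of_right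
    cases D.right_inj.1 e1
    cases e3
    exact ⟨s, e2, hs⟩
  choose s hr hs using hs
  exact ⟨d', Q, s, rfl, hQ, hr, hg, hs⟩

theorem exists_pair (h : Run k d P r) {M N : Prog 0} (h0 : P 0 = .pair M N) :
    ∃ d₁ d₂ Q₁ Q₂ s₁ s₂, d = D.pair d₁ d₂ ∧ (∀ i, P i = .pair (Q₁ i) (Q₂ i)) ∧
      (∀ i, r i = .pair (s₁ i) (s₂ i)) ∧ Run k d₁ Q₁ s₁ ∧ Run k d₂ Q₂ s₂ := by
  have hP : ∀ i, ∃ M N, P i = .pair M N := by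
    intro i
    induction i with
    | zero => exact ⟨M, N, h0⟩
    | succ i ih =>
      obtain ⟨M, N, hN⟩ := ih
      obtain ⟨_, _, _, _, M', N', -, -, e, -⟩ := (hN ▸ h.step i).of_pair
      exact ⟨M', N', e⟩
  choose Q₁ Q₂ hQ using hP
  obtain ⟨d₁, d₂, rfl, hg₁, hg₂⟩ := (hQ 0 ▸ h.goal).pair
  have hs : ∀ i, ∃ s₁ s₂, r i = .pair s₁ s₂ ∧ Strat (k + i) d₁ s₁ (Q₁ i) (Q₁ (i + 1)) ∧
      Strat (k + i) d₂ s₂ (Q₂ i) (Q₂ (i + 1)) := by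
    intro i
    have hi := h.step i
    rw [hQ i, hQ (i + 1)] at hi
    obtain ⟨_, _, s₁, s₂, _, _, e1, e2, e3, hs₁, hs₂⟩ := hi.of_pair
    obtain ⟨rfl, rfl⟩ := D.pair_inj.1 e1
    cases e3
    exact ⟨s₁, s₂, e2, hs₁, hs₂⟩
  choose s₁ s₂ hr hs₁ hs₂ using hs
  exact ⟨d₁, d₂, Q₁, Q₂, s₁, s₂, rfl, hQ, hr, ⟨hg₁, hs₁⟩, ⟨hg₂, hs₂⟩⟩

/-- Runs are fair. -/
theorem not_unfair (h : Run k d P r) : ¬ Unfair P r := by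
  intro hu
  induction hu generalizing k d with
  | ambLeft L R hM hL hr =>
    have hs := fun i => (hr i ▸ hM i ▸ hM (i + 1) ▸ h.step i :
      Strat (k + i) d (.choice .redLeft) (.amb (L i) R) (.amb (L (i + 1)) R)).of_redLeft
    -- Endless progress on one side is possible only if its value is `⊥`. Then every step is an
    -- alternating one, and the consecutive times `k` and `k + 1` would have the same parity.
    have hb := val_eq_bot_of_forall_toward fun i => (hs i).1
    exact Nat.not_even_iff_odd.2 ((hs 0).2 (hb 0)).add_one ((hs 1).2 (hb 1))
  | ambRight L R hM hR hr =>
    have hs := fun i => (hr i ▸ hM i ▸ hM (i + 1) ▸ h.step i :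
      Strat (k + i) d (.choice .redRight) (.amb L (R i)) (.amb L (R (i + 1)))).of_redRight
    have hb := val_eq_bot_of_forall_toward fun i => (hs i).1
    exact (hs 1).2 (hb 1) (Nat.not_even_iff_odd.1 ((hs 0).2 (hb 0))).add_one
  | left N s hM hr _ ih =>
    obtain ⟨d', Q, t, -, hQ, ht, h'⟩ := h.exists_left (hM 0)
    obtain rfl : Q = N := funext fun i => by simp_all
    obtain rfl : t = s := funext fun i => by simp_all
    exact ih h'
  | right N s hM hr _ ih =>
    obtain ⟨d', Q, t, -, hQ, ht, h'⟩ := h.exists_right (hM 0)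
    obtain rfl : Q = N := funext fun i => by simp_all
    obtain rfl : t = s := funext fun i => by simp_all
    exact ih h'
  | pairFst N₁ N₂ s₁ s₂ hM hr _ ih =>
    obtain ⟨d₁, d₂, Q₁, Q₂, t₁, t₂, -, hQ, ht, h', -⟩ := h.exists_pair (hM 0)
    obtain rfl : Q₁ = N₁ := funext fun i => by simp_all
    obtain rfl : t₁ = s₁ := funext fun i => by simp_all
    exact ih h'
  | pairSnd N₁ N₂ s₁ s₂ hM hr _ ih =>
    obtain ⟨d₁, d₂, Q₁, Q₂, t₁, t₂, -, hQ, ht, -, h'⟩ := h.exists_pair (hM 0)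
    obtain rfl : Q₂ = N₂ := funext fun i => by simp_all
    obtain rfl : t₂ = s₂ := funext fun i => by simp_all
    exact ih h'
  | tail _ ih => exact ih h.tail

theorem exists_whnf (h : Run k d P r) (hb : val (P 0) ≠ ⊥) : ∃ j, Whnf (P j) := by
  by_contra hw
  push Not at hw
  exact hb (val_eq_bot_of_forall_toward (fun i => (h.step i).of_not_whnf (hw i)) 0)

/-- A run that starts with `Amb` picks one of its arguments, or it computes `⊥`. -/
theorem exists_not_amb {L R : Prog 0} (h : Run k d P r) (h0 : P 0 = .amb L R) (hd : d ≠ ⊥) :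
    ∃ j, Whnf (P j) ∧ val (P j) ∈ nonAmb := by
  by_contra hn
  push Not at hn
  by_cases hL : Eligible d L
  · have hnext : ∀ i L, P i = .amb L R → Eligible d L →
        ∃ L', P (i + 1) = .amb L' R ∧ Toward L L' := by
      intro i L hi hL
      refine (Strat.of_eligible_left (hi ▸ h.step i) hL).resolve_right fun ⟨hw, e⟩ => ?_
      -- A pick would produce a w.h.n.f. whose value, by tameness of the `Amb`, does not begin with
      -- `Amb`; this is what `hn` excludes.
      exact hn (i + 1) (e ▸ hw) (e ▸ (hi ▸ h.goal_at i).tame_amb.1.1)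
    have hP : ∀ i, ∃ L, P i = .amb L R ∧ Eligible d L := by
      intro i
      induction i with
      | zero => exact ⟨L, h0, hL⟩
      | succ i ih =>
        obtain ⟨L, hi, hL⟩ := ih
        obtain ⟨L', e, ht⟩ := hnext i L hi hL
        exact ⟨L', e, hL.red ht.1⟩
    choose L hP hL using hP
    -- Without a pick the eligible left side is reduced towards a w.h.n.f. forever, so its value is
    -- `⊥`, against eligibility.
    refine (hL 0).1 (val_eq_bot_of_forall_toward (fun i => ?_) 0)
    obtain ⟨L', e, ht⟩ := hnext i _ (hP i) (hL i)
    rw [hP (i + 1)] at e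
    cases e
    exact ht
  · have hR : Eligible d R := by
      rcases (h0 ▸ h.goal).amb with h | h | h
      · exact absurd h hL
      · exact h
      · exact absurd h.2.2 hd
    have hnext : ∀ i R, P i = .amb L R → Eligible d R →
        ∃ R', P (i + 1) = .amb L R' ∧ Toward R R' := by
      intro i R hi hR
      refine (Strat.of_eligible_right (hi ▸ h.step i) hL hR).resolve_right fun ⟨hw, e⟩ => ?_
      exact hn (i + 1) (e ▸ hw) (e ▸ (hi ▸ h.goal_at i).tame_amb.1.2)
    have hP : ∀ i, ∃ R, P i = .amb L R ∧ Eligible d R := by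
      intro i
      induction i with
      | zero => exact ⟨R, h0, hR⟩
      | succ i ih =>
        obtain ⟨R, hi, hR⟩ := ih
        obtain ⟨R', e, ht⟩ := hnext i R hi hR
        exact ⟨R', e, hR.red ht.1⟩
    choose R hP hR using hP
    refine (hR 0).1 (val_eq_bot_of_forall_toward (fun i => ?_) 0)
    obtain ⟨R', e, ht⟩ := hnext i _ (hP i) (hR i)
    rw [hP (i + 1)] at e
    cases e
    exact ht

/-- The first w.h.n.f. of the run may be an `Amb`. Then the rest of the run picks an argument, and
by tameness no second choice follows. -/
theorem exists_whnf_nonAmb (h : Run k d P r) (hd : d ≠ ⊥) :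
    ∃ j, Whnf (P j) ∧ val (P j) ∈ nonAmb := by
  obtain ⟨j, hj⟩ := h.exists_whnf fun hb => hd (h.goal.eq_bot hb)
  by_cases ha : ∃ L R, P j = .amb L R
  · obtain ⟨L, R, ha⟩ := ha
    obtain ⟨i, hi⟩ := (h.drop j).exists_not_amb (L := L) (R := R) (by rwa [Nat.zero_add]) hd
    exact ⟨i + j, hi⟩
  · refine ⟨j, hj, ?_⟩
    generalize P j = M at hj ha
    cases hj with
    | lam M =>
      obtain ⟨f, hf⟩ := exists_val_lam M
      exact fun b c => by simp [hf, ← D.unroll_inj]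
    | con hj =>
      cases hj with
      | amb L R => exact absurd ⟨L, R, rfl⟩ ha
      | _ => exact fun b c => by simp [val_nil, val_left, val_right, val_pair, ← D.unroll_inj]

/-- Each level costs one constructor of `d`: the run arrives at a w.h.n.f. other than `Amb`, and the
runs of its arguments supply the level below. These have other targets, programs and clocks, hence
the generalization. -/
theorem exists_cut_le (h : Run k d P r) (n : ℕ) : ∃ j, d.cut n ≤ (obs (P j)).cut n := by
  induction n generalizing k d P r with
  | zero => exact ⟨0, le_rfl⟩
  | succ n ih =>
    -- If `d` is `⊥` the run may never reach a w.h.n.f., but then there is nothing to produce.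
    by_cases hd : d = ⊥
    · exact ⟨0, hd ▸ bot_le⟩
    obtain ⟨j, hw, ha⟩ := h.exists_whnf_nonAmb hd
    suffices ∃ i, d.cut (n + 1) ≤ (obs (P (i + j))).cut (n + 1) from this.imp' (· + j) fun _ => id
    have h' := h.drop j
    have e0 : P (0 + j) = P j := by rw [Nat.zero_add]
    generalize hM : P j = M at hw ha e0
    cases hw with
    | lam M =>
      refine ⟨0, ?_⟩
      -- A function is observed with its full denotation, so the limit is reached at once.
      rw [e0, ← (hM ▸ h.goal_at j : Goal d (.lam M)).lam]
    | con hw =>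
      cases hw with
      | amb L R => exact absurd (val_amb L R) (ha _ _)
      | nil =>
        refine ⟨0, ?_⟩
        rw [e0, obs_nil, ← (hM ▸ h.goal_at j : Goal d .nil).nil]
      | left N =>
        obtain ⟨d', Q, s, rfl, hQ, -, hr⟩ := h'.exists_left e0
        obtain ⟨i, hi⟩ := ih hr
        refine ⟨i, ?_⟩
        rw [hQ i, obs_left]
        exact Shape.Le.left hi
      | right N =>
        obtain ⟨d', Q, s, rfl, hQ, -, hr⟩ := h'.exists_right e0
        obtain ⟨i, hi⟩ := ih hr
        refine ⟨i, ?_⟩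
        rw [hQ i, obs_right]
        exact Shape.Le.right hi
      | pair N K =>
        obtain ⟨d₁, d₂, Q₁, Q₂, s₁, s₂, rfl, hQ, -, hr₁, hr₂⟩ := h'.exists_pair e0
        obtain ⟨i₁, hi₁⟩ := ih hr₁
        obtain ⟨i₂, hi₂⟩ := ih hr₂
        -- Both components must be good enough at the same time; observations only grow along a run.
        refine ⟨max i₁ i₂, ?_⟩
        rw [hQ, obs_pair]
        exact Shape.Le.pair (hi₁.trans (hr₁.obs_mono (le_max_left i₁ i₂) n))
          (hi₂.trans (hr₂.obs_mono (le_max_right i₁ i₂) n))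

/-- The order of `D` is levelwise, so an upper bound of the observations dominates `d` as soon as
each level of `d` is reached. -/
theorem isLUB_obs (h : Run k d P r) : IsLUB (Set.range fun i => obs (P i)) d := by
  refine ⟨?_, fun b hb n => ?_⟩
  · rintro _ ⟨i, rfl⟩
    exact (h.goal_at i).obs_le
  · obtain ⟨j, hj⟩ := h.exists_cut_le n
    exact hj.trans (hb ⟨j, rfl⟩ n)

end Run

end AmbLang

/-- Every element of `data(⟦M⟧)` is the limit of a fair computation of `M`, for a closed program `M`
whose denotation is a member of a (closed) regular type. -/
theorem theorem3p2 (M : AmbLang.Prog 0) (ρ : AmbLang.Ty 0) (hρ : ρ.Regular)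
    (hM : AmbLang.val M ∈ AmbLang.tval ρ) (d : AmbLang.D) (hd : d ∈ AmbLang.data (AmbLang.val M)) :
    ∃ (P : ℕ → AmbLang.Prog 0) (r : ℕ → AmbLang.Prog.ParRule),
      AmbLang.Prog.IsComputation M P r ∧ IsLUB (Set.range fun i => AmbLang.obs (P i)) d := by
  obtain ⟨P, r, h0, h⟩ := AmbLang.exists_run ⟨hd, AmbLang.tval_subset_tame hρ hM⟩
  exact ⟨P, r, ⟨h0, h.parStep, h.not_unfair⟩, h.isLUB_obs⟩
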